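/- **Setting.** Let $(\mathcal S,\mathcal A,H,P,R)$ be an episodic MDP with horizon $H\ge 1$, measurable state and action spaces, fixed initial state $x_1$, transition kernels $P_h$ and deterministic measurable rewards $R_h:\mathcal S\times\mathcal A\to[0,1]$. Let $\mathcal F=\mathcal F_1\times\dots\times\mathcal F_H$, where each $\mathcal F_h$ is a set of measurable functions $\mathcal S\times\mathcal A\to[0,H]$, and put $f_{H+1}=0$ for $f\in\mathcal F$. Write $\mathcal T_h g(s,a)=R_h(s,a)+\mathbb E_{s'\sim P_h(\cdot\mid s,a)}[\max_{a'}g(s',a')]$, and assume Bellman completeness: $\mathcal T_h g\in\mathcal F_h$ for all $h<H$ and $g\in\mathcal F_{h+1}$, and $\mathcal T_H 0=R_H\in\mathcal F_H$. Every $f\in\mathcal F$ has a (measurable) greedy policy $\pi^f$, with $\pi^f_h(s)\in\arg\max_a f_h(s,a)$; fix one and let $\Pi=\{\pi^f:f\in\mathcal F\}$. For a policy $\pi$ let $d^\pi_h$ be the law of $(s_h,a_h)$ under $\pi$, and $V_1^\pi(x_1)$ the expected total reward; $V_1^\star(x_1)=\sup_\pi V_1^\pi(x_1)$, over all Markov policies.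 Let $\mathcal N_{\mathcal F}(\rho)$ be the $\rho$-covering number of $\mathcal F$ in the supremum norm (over $h,s,a$). **Algorithm (DISC-GOLF).** The offline dataset consists of $N_{\rm off}\ge1$ independent episodes of a fixed policy $\pi_{\rm off}$ with occupancy measures $\mu_h=d_h^{\pi_{\rm off}}$. For online episodes $t=1,\dots,N_{\rm on}$, the algorithm with confidence width $w$ picks $f^{(t)}\in\arg\max_{f\in\mathcal F^{(t-1)}}f_1(x_1,\pi^f_1(x_1))$ (a maximizer is assumed to exist, and to be chosen such that the policy played depends measurably on data and state), plays $\pi^{(t)}=\pi^{f^{(t)}}$ for one episode and records it. Here $$\mathcal F^{(t)}=\Big\{f\in\mathcal F:\ \mathcal L_h^{(t)}(f_h,f_{h+1})-\min_{g\in\mathcal F_h}\mathcal L^{(t)}_h(g,f_{h+1})\le w\ \ \forall h\in[H]\Big\},$$ where $\mathcal L_h^{(t)}(g,g')$ is the sum of $(g(s,a)-r-\max_{a'}g'(s',a'))^2$ over the step-$h$ transitions $(s,a,r,s')$ of all offline episodes and of the first $t$ online episodes. In particular $\mathcal F^{(0)}$ is the confidence set of the offline data alone. **Complexities.** For measurable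 $\mathcal X_{\rm off},\mathcal X_{\rm on}\subseteq\mathcal S\times\mathcal A\times[H]$ and $\delta_h f=f_h-\mathcal T_hf_{h+1}$ let (with $0/0=0$, and $c/0=\infty$ for $c>0$) $$c_{\rm off}(\mathcal F,\mathcal X_{\rm off})=\max_h\sup_{f\in\mathcal F}\sup_{\pi\in\Pi}\frac{\mathbb E_{d_h^\pi}[(\delta_hf)^2\mathbb 1_{(\cdot,h)\in\mathcal X_{\rm off}}]}{\mathbb E_{\mu_h}[(\delta_hf)^2\mathbb 1_{(\cdot,h)\in\mathcal X_{\rm off}}]},$$ $$c_{\rm on}(\mathcal F,\mathcal X_{\rm on},T)=\max_h\sup_{f^{(1)},\dots,f^{(T)}\in\mathcal F}\ \sup_{\pi^{(1)},\dots,\pi^{(T)}\in\Pi}\ \sum_{t=1}^T\frac{\big(\mathbb E_{d_h^{\pi^{(t)}}}[\delta_hf^{(t)}\,\mathbb 1_{(\cdot,h)\in\mathcal X_{\rm on}}]\big)^2}{H^2\vee\sum_{i<t}\mathbb E_{d_h^{\pi^{(i)}}}[(\delta_hf^{(t)})^2\,\mathbb 1_{(\cdot,h)\in\mathcal X_{\rm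 on}}]}.$$ **Theorem.** There are universal constants $c_1,C>0$ such that the following holds in every such setting, for all $N_{\rm off}\ge1$, $N_{\rm on}\ge0$ and $\delta\in(0,1)$. Put $N=N_{\rm off}+N_{\rm on}$, assume $\mathcal N_{\mathcal F}(1/N)<\infty$, let $\beta=c_1\log\big(NH\,\mathcal N_{\mathcal F}(1/N)/\delta\big)$, and run DISC-GOLF with confidence width $w=H^2\beta$. Then with probability at least $1-\delta$ over the offline and online data the regret $\mathrm{Reg}(N_{\rm on})=\sum_{t=1}^{N_{\rm on}}\big(V_1^\star(x_1)-V_1^{\pi^{(t)}}(x_1)\big)$ satisfies $$\mathrm{Reg}(N_{\rm on})\le C\inf_{\mathcal X_{\rm off}\cup\mathcal X_{\rm on}=\mathcal S\times\mathcal A\times[H]}\left(\sqrt{\beta H^4\frac{N_{\rm on}^2}{N_{\rm off}}\,c_{\rm off}(\mathcal F,\mathcal X_{\rm off})}+\sqrt{\beta H^4N_{\rm on}\,c_{\rm on}(\mathcal F,\mathcal X_{\rm on},N_{\rm on})}\right),$$ the infimum being over all measurable, not necessarily disjoint partitions. If the first function is instead chosen from all of $\mathcal F$ (that is, $\mathcal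 F^{(0)}=\mathcal F$), the same holds with $H$ added to the right-hand side. -/

import Mathlib

open MeasureTheory ProbabilityTheory
open scoped ENNReal NNReal

universe u v

noncomputable section

namespace HybridRL

/-- An episodic Markov decision process with fixed initial state `x₁`. Steps are numbered
`0, …, H - 1`; the data `P h`, `R h` with `h ≥ H` play no role. -/
structure MDP (S : Type u) (A : Type v) [MeasurableSpace S] [MeasurableSpace A] where
  /-- horizon -/
  H : ℕ
  /-- initial state of every episode -/
  x₁ : S
  /-- transition probabilities -/
  P : ℕ → Kernel (S × A) S
  markov : ∀ h, IsMarkovKernel (P h)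
  /-- deterministic rewards in `[0, 1]` -/
  R : ℕ → S × A → ℝ
  measurable_R : ∀ h, Measurable (R h)
  R_mem : ∀ h x, R h x ∈ Set.Icc (0 : ℝ) 1

/-- A (randomized, step dependent) Markov policy. -/
structure Policy (S : Type u) (A : Type v) [MeasurableSpace S] [MeasurableSpace A] where
  act : ℕ → Kernel S A
  markov : ∀ h, IsMarkovKernel (act h)

/-- The deterministic policy that plays `g h s` in state `s` at step `h`. -/
def Policy.ofFun {S : Type u} {A : Type v} [MeasurableSpace S] [MeasurableSpace A]
    (g : ℕ → S → A) (hg : ∀ h, Measurable (g h)) : Policy S A where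
  act h := Kernel.deterministic (g h) (hg h)
  markov _ := inferInstance

/-- A recorded transition `((s_h, a_h), s_{h+1})`. -/
abbrev Transition (S : Type u) (A : Type v) : Type (max u v) := (S × A) × S

/-- A Q-function candidate `f = (f_0, f_1, …)`, one function on `S × A` per step. -/
abbrev QFun (S : Type u) (A : Type v) : Type (max u v) := ℕ → S × A → ℝ

variable {S : Type u} {A : Type v} [MeasurableSpace S] [MeasurableSpace A]

/-- The current state after `n` recorded transitions. -/
def curState (x₁ : S) : (n : ℕ) → (Fin n → Transition S A) → S
  | 0, _ => x₁
  | n + 1, τ => (τ (Fin.last n)).2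

theorem measurable_curState (x₁ : S) (n : ℕ) :
    Measurable (curState (A := A) x₁ n) := by
  cases n with
  | zero => exact measurable_const
  | succ n => exact measurable_snd.comp (measurable_pi_apply (Fin.last n))

namespace MDP

variable (M : MDP S A)

/-- A full episode: the `H` transitions. The rewards are `R h (s_h, a_h)`. -/
abbrev Episode : Type (max u v) := Fin M.H → Transition S A

/-- One step of the interaction at step `h` from state `s`: draw `a ∼ π_h(· | s)`, then
`s' ∼ P_h(· | s, a)`, and record `((s, a), s')`. -/
def stepKernel (π : Policy S A) (h : ℕ) : Kernel S (Transition S A) :=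
  (Kernel.id ×ₖ M.P h) ∘ₖ (Kernel.id ×ₖ π.act h)

/-- The law of the first `n` transitions when `π` is run from `x₁`. -/
def trajLaw (π : Policy S A) : (n : ℕ) → Measure (Fin n → Transition S A)
  | 0 => Measure.dirac Fin.elim0
  | n + 1 =>
    ((trajLaw π n) ⊗ₘ
      ((M.stepKernel π n).comap (curState M.x₁ n) (measurable_curState M.x₁ n))).map
      (fun p => (Fin.snoc p.1 p.2 : Fin (n + 1) → Transition S A))

/-- The occupancy measure `d_h^π`: the law of `(s_h, a_h)` under `π`. -/
def occ (π : Policy S A) (h : ℕ) : Measure (S × A) :=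
  (M.trajLaw π (h + 1)).map (fun τ => (τ (Fin.last h)).1)

/-- The value `V_1^π(x₁)`: the expected total reward of an episode under `π`. -/
def value (π : Policy S A) : ℝ :=
  ∫ τ : M.Episode, ∑ h : Fin M.H, M.R h (τ h).1 ∂(M.trajLaw π M.H)

/-- The optimal value `V_1^⋆(x₁)`. -/
def optValue : ℝ := ⨆ π : Policy S A, M.value π

/-- The Bellman operator `(𝒯_h g)(s, a) = R_h(s, a) + 𝔼_{s' ∼ P_h(· | s, a)} max_{a'} g(s', a')`. -/
def bellman (h : ℕ) (g : S × A → ℝ) (x : S × A) : ℝ :=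
  M.R h x + ∫ s', (⨆ a', g (s', a')) ∂(M.P h x)

/-- The Bellman error `f_h - 𝒯_h f_{h+1}`. -/
def bellmanErr (f : QFun S A) (h : ℕ) (x : S × A) : ℝ :=
  f h x - M.bellman h (f (h + 1)) x

/-- The class `ℱ = ℱ_0 × ⋯ × ℱ_{H-1}`, with the convention `f_h = 0` for `h ≥ H`. -/
def fnClass (F : ℕ → Set (S × A → ℝ)) : Set (QFun S A) :=
  {f | (∀ h < M.H, f h ∈ F h) ∧ ∀ h, M.H ≤ h → f h = 0}

/-- `F` consists of measurable functions with values in `[0, H]`. -/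
def IsBoundedClass (F : ℕ → Set (S × A → ℝ)) : Prop :=
  ∀ h < M.H, ∀ g ∈ F h, Measurable g ∧ ∀ x, g x ∈ Set.Icc (0 : ℝ) M.H

/-- Bellman completeness. For the last step it reads `R_{H-1} = 𝒯_{H-1} 0 ∈ ℱ_{H-1}`. -/
def BellmanComplete (F : ℕ → Set (S × A → ℝ)) : Prop :=
  (∀ h, h + 1 < M.H → ∀ g ∈ F (h + 1), M.bellman h g ∈ F h) ∧
    ∀ h, h + 1 = M.H → M.bellman h 0 ∈ F h

/-- The `ρ`-covering number of `ℱ` with respect to the supremum norm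
(over steps, states and actions). -/
def coverNum (F : ℕ → Set (S × A → ℝ)) (ρ : ℝ≥0) : ℕ∞ :=
  Metric.coveringNumber ρ
    ((fun f : QFun S A => UniformFun.ofFun (fun p : ℕ × (S × A) => f p.1 p.2)) '' M.fnClass F)

/-- A rule that assigns to every `f ∈ ℱ` a greedy policy `π^f`. In particular the maximum
of `f_h(s, ·)` is attained. (The values of the rule outside `ℱ` are irrelevant.) -/
structure GreedyRule (F : ℕ → Set (S × A → ℝ)) where
  act : QFun S A → ℕ → S → A
  measurable_act : ∀ f h, Measurable (act f h)
  act_max : ∀ f ∈ M.fnClass F, ∀ h < M.H, ∀ s a, f h (s, a) ≤ f h (s, act f h s)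

variable {M}

/-- The greedy policy `π^f`. -/
def GreedyRule.policy {F : ℕ → Set (S × A → ℝ)} (G : M.GreedyRule F) (f : QFun S A) :
    Policy S A :=
  Policy.ofFun (G.act f) (G.measurable_act f)

variable (M)

/-! ### Complexity measures; a set `X ⊆ S × A × [H]` is given by its slices `X h ⊆ S × A`. -/

/-- `‖(f_h - 𝒯_h f_{h+1}) 𝟙_{X_h}‖²_{2,d}`. -/
def sqErr (d : Measure (S × A)) (X : ℕ → Set (S × A)) (f : QFun S A) (h : ℕ) : ℝ≥0∞ :=
  ∫⁻ x in X h, ENNReal.ofReal (M.bellmanErr f h x ^ 2) ∂d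

/-- The partial all-policy concentrability coefficient `c_off(ℱ, X)` (with `0 / 0 = 0` and
`c / 0 = ∞` for `c > 0`); the policies range over `Π = {π^f : f ∈ ℱ}`. -/
def cOff {F : ℕ → Set (S × A → ℝ)} (G : M.GreedyRule F) (πoff : Policy S A)
    (X : ℕ → Set (S × A)) : ℝ≥0∞ :=
  ⨆ (h : Fin M.H) (f : M.fnClass F) (g : M.fnClass F),
    M.sqErr (M.occ (G.policy g.1) h) X f.1 h / M.sqErr (M.occ πoff h) X f.1 h

/-- The partial sequential extrapolation coefficient `c_on(ℱ, X, T)`; the policies range over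
`Π = {π^f : f ∈ ℱ}`. -/
def cOn {F : ℕ → Set (S × A → ℝ)} (G : M.GreedyRule F)
    (X : ℕ → Set (S × A)) (T : ℕ) : ℝ≥0∞ :=
  ⨆ (h : Fin M.H) (f : Fin T → M.fnClass F) (g : Fin T → M.fnClass F),
    ∑ t : Fin T,
      ENNReal.ofReal ((∫ x in X h, M.bellmanErr (f t).1 h x ∂(M.occ (G.policy (g t).1) h)) ^ 2) /
        max ((M.H : ℝ≥0∞) ^ 2)
          (∑ i : Fin T with i < t, M.sqErr (M.occ (G.policy (g i).1) h) X (f t).1 h)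

/-- `X_off ∪ X_on = S × A × [H]`, both measurable, not necessarily disjoint. -/
def IsPartition (Xoff Xon : ℕ → Set (S × A)) : Prop :=
  (∀ h, MeasurableSet (Xoff h)) ∧ (∀ h, MeasurableSet (Xon h)) ∧
    ∀ h < M.H, Xoff h ∪ Xon h = Set.univ

/-! ### The algorithm -/

/-- The data available after `t` online episodes: the offline dataset of `Noff` episodes and the
`t` online episodes. -/
abbrev History (Noff t : ℕ) : Type (max u v) :=
  (Fin Noff → M.Episode) × (Fin t → M.Episode)

/-- The squared loss `(g(s, a) - r - max_{a'} g'(s', a'))²` of one transition at step `h`. -/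
def transLoss (h : ℕ) (g g' : S × A → ℝ) (z : Transition S A) : ℝ :=
  (g z.1 - M.R h z.1 - ⨆ a', g' (z.2, a')) ^ 2

/-- The loss `ℒ_h^{(t)}(g, g')` on the offline and the online data. -/
def loss {Noff t : ℕ} (D : M.History Noff t) (h : Fin M.H) (g g' : S × A → ℝ) : ℝ :=
  (∑ i : Fin Noff, M.transLoss h g g' (D.1 i h)) + ∑ i : Fin t, M.transLoss h g g' (D.2 i h)

/-- The set of `f ∈ ℱ` with
`ℒ_h(f_h, f_{h+1}) - min_{g ∈ ℱ_h} ℒ_h(g, f_{h+1}) ≤ w` for all `h`. -/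
def confSet (F : ℕ → Set (S × A → ℝ)) (w : ℝ) {Noff t : ℕ} (D : M.History Noff t) :
    Set (QFun S A) :=
  {f | f ∈ M.fnClass F ∧ ∀ h : Fin M.H, ∀ g ∈ F h,
    M.loss D h (f h) (f (h + 1)) - M.loss D h g (f (h + 1)) ≤ w}

/-- The set from which the next function is chosen after `t` online episodes. If `warm` holds it is
the confidence set of all the data gathered so far, in every round. If not, then the very first
choice is made from all of `ℱ`. -/
def candidates (F : ℕ → Set (S × A → ℝ)) (w : ℝ) (warm : Bool) {Noff t : ℕ}
    (D : M.History Noff t) : Set (QFun S A) :=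
  if t = 0 ∧ warm = false then M.fnClass F else M.confSet F w D

/-- `sel` is an implementation of DISC-GOLF with confidence width `w`: after `t < Non` online
episodes with data `D` it chooses a maximizer `sel t D` of `f ↦ f_1(x₁, π^f_1(x₁))` among the
candidates. The policy played is a measurable function of data and state. -/
structure IsDiscGolf {F : ℕ → Set (S × A → ℝ)} (G : M.GreedyRule F) (w : ℝ) (warm : Bool)
    (Noff Non : ℕ) (sel : (t : ℕ) → M.History Noff t → QFun S A) : Prop where
  mem : ∀ t < Non, ∀ D, sel t D ∈ M.candidates F w warm D
  argmax : ∀ t < Non, ∀ D, ∀ f ∈ M.candidates F w warm D,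
    f 0 (M.x₁, G.act f 0 M.x₁) ≤ sel t D 0 (M.x₁, G.act (sel t D) 0 M.x₁)
  measurable_play : ∀ t < Non, ∀ h < M.H,
    Measurable fun p : M.History Noff t × S => G.act (sel t p.1) h p.2

/-- The law of the data after `t` online episodes: the offline episodes are i.i.d. from `πoff`, and,
given the data `D` so far, the next episode is run with the greedy policy of `sel t D`. -/
def runLaw {F : ℕ → Set (S × A → ℝ)} (G : M.GreedyRule F) (πoff : Policy S A) {Noff : ℕ}
    (sel : (t : ℕ) → M.History Noff t → QFun S A) : (t : ℕ) → Measure (M.History Noff t)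
  | 0 => (Measure.pi fun _ : Fin Noff => M.trajLaw πoff M.H).map fun D => (D, Fin.elim0)
  | t + 1 => (runLaw G πoff sel t).bind fun D =>
      (M.trajLaw (G.policy (sel t D)) M.H).map fun e =>
        (D.1, (Fin.snoc D.2 e : Fin (t + 1) → M.Episode))

/-- The data that were available after the first `t` of `T` online episodes. -/
def History.upTo {M : MDP S A} {Noff T : ℕ} (D : M.History Noff T) (t : Fin T) :
    M.History Noff t :=
  (D.1, fun i => D.2 (Fin.castLE t.isLt.le i))

/-- The regret `∑_t (V_1^⋆(x₁) - V_1^{π^{(t)}}(x₁))`, a function of the observed data. -/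
def regret {F : ℕ → Set (S × A → ℝ)} (G : M.GreedyRule F) {Noff T : ℕ}
    (sel : (t : ℕ) → M.History Noff t → QFun S A) (D : M.History Noff T) : ℝ :=
  ∑ t : Fin T, (M.optValue - M.value (G.policy (sel t (History.upTo D t))))

/-- The regret bound without its constant: the infimum over all partitions of
`√(β H⁴ (Non² / Noff) c_off(ℱ, X_off)) + √(β H⁴ Non c_on(ℱ, X_on, Non))`. -/
def regretBound {F : ℕ → Set (S × A → ℝ)} (G : M.GreedyRule F) (πoff : Policy S A)
    (Noff Non : ℕ) (β : ℝ) : ℝ≥0∞ :=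
  ⨅ (Xoff : ℕ → Set (S × A)) (Xon : ℕ → Set (S × A)) (_ : M.IsPartition Xoff Xon),
    (ENNReal.ofReal β * (M.H : ℝ≥0∞) ^ 4 * ((Non : ℝ≥0∞) ^ 2 / (Noff : ℝ≥0∞)) *
        M.cOff G πoff Xoff) ^ (1 / 2 : ℝ) +
      (ENNReal.ofReal β * (M.H : ℝ≥0∞) ^ 4 * (Non : ℝ≥0∞) * M.cOn G Xon Non) ^ (1 / 2 : ℝ)

/-- `β = c₁ log(N H 𝒩_ℱ(1/N) / δ)`. -/
def betaParam (F : ℕ → Set (S × A → ℝ)) (c₁ : ℝ) (N : ℕ) (δ : ℝ) : ℝ :=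
  c₁ * Real.log ((N : ℝ) * M.H * ((M.coverNum F (1 / (N : ℝ≥0))).toNat : ℝ) / δ)

end MDP

end HybridRL

end

noncomputable section

namespace HybridRL

variable {S : Type u} {A : Type v} [MeasurableSpace S] [MeasurableSpace A]

-- The proof combines optimism with a concentration bound for squared losses. Under any policy, the
-- excess loss of `f h` over its Bellman backup on a step-`h` transition has mean `E[(δ_h f)²]`,
-- because the noise in the regression target averages out, and its second moment is at most `16 H²`
-- times that mean (`integral_excess`, `integral_sq_excess_le`). So `exp(λ (mean / 2 - excess))`
-- with `λ = 1 / (32 H²)` has expectation at most 1. Multiplying over episodes gives weights of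
-- expectation at most 1 although the online policies depend on the data
-- (`lintegral_runWeight_le_one`). Markov's inequality, a union bound over rounds, steps and a
-- finite `1/N`-cover, and a Lipschitz argument show that with probability at least `1 - δ`, for all
-- `f` at once, half the cumulative squared Bellman error is at most the cumulative excess loss plus
-- `w` (`runLaw_not_concentrated_le`).
--
-- On this event everything is deterministic. The optimal Q-function stays in every confidence set,
-- and completeness makes `𝒯_h f_{h+1}` an admissible competitor, so every member of a confidence
-- set has cumulative squared Bellman error at most `4 w`, offline and past online episodes
-- together. By optimism and telescoping, the regret of a round is at most the sum over steps of the
-- expected Bellman errors of the chosen function under its own greedy policy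
-- (`optValue_sub_value_le`). Each such expectation is split along the partition. The offline part
-- is transferred to the offline law by `cOff` after Cauchy–Schwarz; the online part is summed over
-- rounds by Cauchy–Schwarz against the ratios in `cOn`. The algorithm never sees the partition, so
-- the infimum can be taken at the end.

attribute [instance] MDP.markov Policy.markov

namespace MDP

/-! ### Trajectory laws and occupancy measures. -/

section

variable (M : MDP S A) (π : Policy S A)

instance isMarkovKernel_stepKernel (h : ℕ) : IsMarkovKernel (M.stepKernel π h) := by
  unfold stepKernel; infer_instance

theorem measurable_snoc {E : Type*} [MeasurableSpace E] (n : ℕ) :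
    Measurable (fun p : (Fin n → E) × E => (Fin.snoc p.1 p.2 : Fin (n + 1) → E)) := by
  refine measurable_pi_lambda _ fun i => ?_
  refine Fin.lastCases ?_ (fun j => ?_) i
  · simpa using measurable_snd
  · simpa using (measurable_pi_apply j).fun_comp measurable_fst

instance isProbabilityMeasure_trajLaw (n : ℕ) : IsProbabilityMeasure (M.trajLaw π n) := by
  induction n with
  | zero => unfold trajLaw; infer_instance
  | succ n ih =>
    unfold trajLaw
    exact Measure.isProbabilityMeasure_map (measurable_snoc n).aemeasurable

/-- The law of the state at step `n`. -/
def stateLaw (n : ℕ) : Measure S := (M.trajLaw π n).map (curState M.x₁ n)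

instance isProbabilityMeasure_stateLaw (n : ℕ) : IsProbabilityMeasure (M.stateLaw π n) :=
  Measure.isProbabilityMeasure_map (measurable_curState M.x₁ n).aemeasurable

instance isProbabilityMeasure_occ (n : ℕ) : IsProbabilityMeasure (M.occ π n) :=
  Measure.isProbabilityMeasure_map
    ((measurable_pi_apply (Fin.last n)).fst).aemeasurable

theorem stateLaw_zero : M.stateLaw π 0 = Measure.dirac M.x₁ :=
  Measure.map_dirac' (measurable_curState M.x₁ 0) _

/-- The new transition depends on the past only through the current state, so its law factors as
state, action, next state. Every later statement about occupancies rests on this. -/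
theorem map_last_trajLaw (n : ℕ) :
    (M.trajLaw π (n + 1)).map (fun τ => τ (Fin.last n)) =
      (M.stateLaw π n ⊗ₘ π.act n) ⊗ₘ M.P n := by
  have h1 : (M.trajLaw π (n + 1)).map (fun τ => τ (Fin.last n)) =
      (M.trajLaw π n ⊗ₘ
      ((M.stepKernel π n).comap (curState M.x₁ n) (measurable_curState M.x₁ n))).snd := by
    conv_lhs => unfold trajLaw
    rw [Measure.map_map (measurable_pi_apply _) (measurable_snoc n), Measure.snd]
    congr 1
    ext p : 1
    simp
  rw [h1, Measure.snd_compProd, ← Kernel.comp_deterministic_eq_comap, ← Measure.comp_assoc,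
    Measure.deterministic_comp_eq_map]
  rw [Measure.compProd_eq_comp_prod (M.stateLaw π n ⊗ₘ π.act n), Measure.compProd_eq_comp_prod,
    Measure.comp_assoc]
  rfl

theorem occ_eq_compProd (n : ℕ) : M.occ π n = M.stateLaw π n ⊗ₘ π.act n := by
  have : M.occ π n = ((M.trajLaw π (n + 1)).map (fun τ => τ (Fin.last n))).fst := by
    rw [Measure.fst, Measure.map_map measurable_fst (measurable_pi_apply _)]
    rfl
  rw [this, map_last_trajLaw, Measure.fst_compProd]

theorem stateLaw_succ (n : ℕ) : M.stateLaw π (n + 1) = (M.occ π n ⊗ₘ M.P n).snd := by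
  rw [occ_eq_compProd, ← map_last_trajLaw, Measure.snd,
    Measure.map_map measurable_snd (measurable_pi_apply _)]
  rfl

/-- Consistency of the laws of different lengths; it lets `occ`, defined through a trajectory cut
after step `h`, be read off a full episode. -/
theorem map_castLE_trajLaw (n m : ℕ) (hnm : n ≤ m) :
    (M.trajLaw π m).map (fun τ i => τ (Fin.castLE hnm i)) = M.trajLaw π n := by
  induction m, hnm using Nat.le_induction with
  | base => simp
  | succ m hm ih =>
    conv_rhs => rw [← ih]
    have : M.trajLaw π m = ((M.trajLaw π m ⊗ₘ
      ((M.stepKernel π m).comap (curState M.x₁ m) (measurable_curState M.x₁ m)))).fst := by simp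
    conv_rhs => rw [this]
    rw [Measure.fst, Measure.map_map (by fun_prop) measurable_fst]
    conv_lhs => unfold trajLaw
    rw [Measure.map_map (by fun_prop) (measurable_snoc m)]
    congr 1
    ext p i : 2
    have : Fin.castLE (hm.trans (Nat.le_succ m)) i = (Fin.castLE hm i).castSucc := rfl
    simp only [Function.comp]
    erw [this, Fin.snoc_castSucc]

/-- The law of the transition at step `h` of an episode. -/
theorem map_eval_trajLaw (n : ℕ) (h : Fin n) :
    (M.trajLaw π n).map (fun τ => τ h) = M.occ π h ⊗ₘ M.P h := by
  rw [occ_eq_compProd, ← map_last_trajLaw, ← map_castLE_trajLaw M π (h + 1) n h.isLt,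
    Measure.map_map (measurable_pi_apply _) (by fun_prop)]
  rfl

theorem stateLaw_ofFun_occ (g : ℕ → S → A) (hg : ∀ h, Measurable (g h)) (n : ℕ) :
    M.occ (Policy.ofFun g hg) n =
      (M.stateLaw (Policy.ofFun g hg) n).map (fun s => (s, g n s)) := by
  rw [occ_eq_compProd]
  exact Measure.compProd_deterministic (hg n)

end

/-! ### Greedy values, the optimal Q-function and the Bellman error decomposition. -/

section

/-- The greedy value `max_a g(s, a)` of a function on state-action pairs. -/
def maxVal (g : S × A → ℝ) (s : S) : ℝ := ⨆ a, g (s, a)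

omit [MeasurableSpace S] [MeasurableSpace A] in
theorem maxVal_zero : maxVal (0 : S × A → ℝ) = 0 := by
  ext s
  simp [maxVal]

variable {M : MDP S A} {F : ℕ → Set (S × A → ℝ)}

theorem mem_Icc_of_mem_fnClass (hB : M.IsBoundedClass F) {f : QFun S A} (hf : f ∈ M.fnClass F)
    (h : ℕ) (x : S × A) : f h x ∈ Set.Icc (0 : ℝ) M.H := by
  by_cases hh : h < M.H
  · exact (hB h hh _ (hf.1 h hh)).2 x
  · rw [hf.2 h (not_lt.1 hh)]
    simp

theorem measurable_of_mem_fnClass (hB : M.IsBoundedClass F) {f : QFun S A}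
    (hf : f ∈ M.fnClass F) (h : ℕ) : Measurable (f h) := by
  by_cases hh : h < M.H
  · exact (hB h hh _ (hf.1 h hh)).1
  · rw [hf.2 h (not_lt.1 hh)]
    exact measurable_const

theorem GreedyRule.nonempty_action (G : M.GreedyRule F) : Nonempty A :=
  ⟨G.act (fun _ _ => 0) 0 M.x₁⟩

theorem bddAbove_of_mem_fnClass (hB : M.IsBoundedClass F) {f : QFun S A}
    (hf : f ∈ M.fnClass F) (h : ℕ) (s : S) : BddAbove (Set.range fun a => f h (s, a)) :=
  ⟨M.H, by rintro _ ⟨a, rfl⟩; exact (mem_Icc_of_mem_fnClass hB hf h _).2⟩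

theorem le_maxVal (hB : M.IsBoundedClass F) {f : QFun S A}
    (hf : f ∈ M.fnClass F) (h : ℕ) (x : S × A) : f h x ≤ maxVal (f h) x.1 :=
  le_ciSup (bddAbove_of_mem_fnClass hB hf h x.1) x.2

theorem maxVal_eq (G : M.GreedyRule F) (hB : M.IsBoundedClass F) {f : QFun S A}
    (hf : f ∈ M.fnClass F) (h : ℕ) (s : S) : maxVal (f h) s = f h (s, G.act f h s) := by
  have := G.nonempty_action
  refine le_antisymm (ciSup_le fun a => ?_) (le_maxVal hB hf h (s, _))
  -- The rule is required to be greedy only before the horizon; afterwards `f h = 0` and any action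
  -- is a maximizer.
  by_cases hh : h < M.H
  · exact G.act_max f hf h hh s a
  · simp [hf.2 h (not_lt.1 hh)]

theorem maxVal_mem_Icc (G : M.GreedyRule F) (hB : M.IsBoundedClass F) {f : QFun S A}
    (hf : f ∈ M.fnClass F) (h : ℕ) (s : S) : maxVal (f h) s ∈ Set.Icc (0 : ℝ) M.H := by
  rw [maxVal_eq G hB hf]
  exact mem_Icc_of_mem_fnClass hB hf h _

/-- A supremum over an arbitrary action space need not be measurable; here it is attained along the
measurable greedy rule. -/
theorem measurable_maxVal (G : M.GreedyRule F) (hB : M.IsBoundedClass F) {f : QFun S A}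
    (hf : f ∈ M.fnClass F) (h : ℕ) : Measurable (maxVal (f h)) := by
  rw [funext (maxVal_eq G hB hf h)]
  exact (measurable_of_mem_fnClass hB hf h).comp (measurable_id.prodMk (G.measurable_act f h))

theorem bellman_mem (hC : M.BellmanComplete F) {f : QFun S A} (hf : f ∈ M.fnClass F)
    {h : ℕ} (hh : h < M.H) : M.bellman h (f (h + 1)) ∈ F h := by
  rcases Nat.lt_or_ge (h + 1) M.H with h1 | h1
  · exact hC.1 h h1 _ (hf.1 _ h1)
  · rw [hf.2 _ h1]
    exact hC.2 h (le_antisymm hh h1)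

theorem update_mem_fnClass {f : QFun S A} (hf : f ∈ M.fnClass F) {h : ℕ} (hh : h < M.H)
    {g : S × A → ℝ} (hg : g ∈ F h) : Function.update f h g ∈ M.fnClass F := by
  refine ⟨fun k hk => ?_, fun k hk => ?_⟩
  · rcases eq_or_ne k h with rfl | hne
    · simpa using hg
    · simpa [hne] using hf.1 k hk
  · rw [Function.update_of_ne (by omega)]
    exact hf.2 k hk

variable (M) in
/-- The optimal Q-function. -/
def optQ (h : ℕ) : S × A → ℝ :=
  if h < M.H then M.bellman h (optQ (h + 1)) else 0
termination_by M.H - h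

theorem optQ_of_lt {h : ℕ} (hh : h < M.H) : M.optQ h = M.bellman h (M.optQ (h + 1)) := by
  rw [optQ, if_pos hh]

theorem optQ_of_le {h : ℕ} (hh : M.H ≤ h) : M.optQ h = 0 := by
  rw [optQ, if_neg (not_lt.2 hh)]

/-- Backward induction from the last step: completeness keeps each Bellman backup inside the class.
-/
theorem optQ_mem_fnClass (hC : M.BellmanComplete F) : M.optQ ∈ M.fnClass F := by
  refine ⟨fun h hh => ?_, fun h hh => optQ_of_le hh⟩
  obtain ⟨k, hk⟩ : ∃ k, h + 1 + k = M.H := ⟨M.H - (h + 1), by omega⟩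
  induction k generalizing h with
  | zero =>
    rw [optQ_of_lt hh, optQ_of_le (by omega)]
    exact hC.2 h hk
  | succ k ih =>
    rw [optQ_of_lt hh]
    exact hC.1 h (by omega) _ (ih (h + 1) (by omega) (by omega))

theorem bellmanErr_optQ {h : ℕ} (hh : h < M.H) (x : S × A) : M.bellmanErr M.optQ h x = 0 := by
  rw [bellmanErr, optQ_of_lt hh, sub_self]

theorem integrable_of_Icc {Ω : Type*} [MeasurableSpace Ω] {μ : Measure Ω} [IsFiniteMeasure μ]
    {g : Ω → ℝ} (hg : Measurable g) {a b : ℝ} (hab : ∀ x, g x ∈ Set.Icc a b) :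
    Integrable g μ :=
  Integrable.of_mem_Icc a b hg.aemeasurable (ae_of_all _ hab)

theorem integrable_reward (μ : Measure (S × A)) [IsFiniteMeasure μ] (h : ℕ) :
    Integrable (M.R h) μ :=
  integrable_of_Icc (M.measurable_R h) (M.R_mem h)

variable (M) in
theorem value_eq_sum (π : Policy S A) :
    M.value π = ∑ h ∈ Finset.range M.H, ∫ x, M.R h x ∂(M.occ π h) := by
  have key : ∀ h : Fin M.H, M.occ π h = (M.trajLaw π M.H).map (fun τ => (τ h).1) := by
    intro h
    have h1 := congrArg Measure.fst (M.map_eval_trajLaw π M.H h)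
    rw [Measure.fst_compProd] at h1
    rw [← h1, Measure.fst, Measure.map_map measurable_fst (measurable_pi_apply _)]
    rfl
  have hm : ∀ h : Fin M.H, Measurable fun τ : M.Episode => (τ h).1 :=
    fun h => (measurable_pi_apply h).fst
  unfold value
  rw [integral_finsetSum, ← Fin.sum_univ_eq_sum_range (fun h => ∫ x, M.R h x ∂(M.occ π h))]
  · refine Finset.sum_congr rfl fun h _ => ?_
    rw [key, integral_map (hm h).aemeasurable (M.measurable_R h).aestronglyMeasurable]
  · exact fun h _ => integrable_of_Icc ((M.measurable_R h).comp (hm h)) (fun τ => M.R_mem _ _)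

theorem integrable_fnClass (hB : M.IsBoundedClass F) {f : QFun S A} (hf : f ∈ M.fnClass F)
    (h : ℕ) (μ : Measure (S × A)) [IsFiniteMeasure μ] : Integrable (f h) μ :=
  integrable_of_Icc (measurable_of_mem_fnClass hB hf h) (mem_Icc_of_mem_fnClass hB hf h)

theorem integrable_maxVal (G : M.GreedyRule F) (hB : M.IsBoundedClass F) {f : QFun S A}
    (hf : f ∈ M.fnClass F) (h : ℕ) (μ : Measure S) [IsFiniteMeasure μ] :
    Integrable (maxVal (f h)) μ :=
  integrable_of_Icc (measurable_maxVal G hB hf h) (maxVal_mem_Icc G hB hf h)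

theorem integrable_bellman (hB : M.IsBoundedClass F) (hC : M.BellmanComplete F) {f : QFun S A}
    (hf : f ∈ M.fnClass F) {h : ℕ} (hh : h < M.H) (μ : Measure (S × A)) [IsFiniteMeasure μ] :
    Integrable (M.bellman h (f (h + 1))) μ :=
  have hb := hB h hh _ (bellman_mem hC hf hh)
  integrable_of_Icc hb.1 hb.2

/-- Tower property: averaging the transition kernel over the occupancy measure gives the law of the
next state. This is what makes Bellman errors telescope. -/
theorem integral_bellman (G : M.GreedyRule F) (hB : M.IsBoundedClass F) {f : QFun S A}
    (hf : f ∈ M.fnClass F) (π : Policy S A) (h : ℕ) :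
    ∫ x, M.bellman h (f (h + 1)) x ∂(M.occ π h) =
      ∫ x, M.R h x ∂(M.occ π h) + ∫ s, maxVal (f (h + 1)) s ∂(M.stateLaw π (h + 1)) := by
  have hm := measurable_maxVal G hB hf (h + 1)
  have hint : Integrable (fun p : (S × A) × S => maxVal (f (h + 1)) p.2) (M.occ π h ⊗ₘ M.P h) :=
    integrable_of_Icc (hm.comp measurable_snd) (fun p => maxVal_mem_Icc G hB hf _ _)
  have h2 : ∫ s, maxVal (f (h + 1)) s ∂(M.stateLaw π (h + 1)) =
      ∫ x, ∫ s, maxVal (f (h + 1)) s ∂(M.P h x) ∂(M.occ π h) := by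
    rw [stateLaw_succ, Measure.snd, integral_map measurable_snd.aemeasurable
      hm.aestronglyMeasurable, Measure.integral_compProd hint]
  rw [h2]
  exact integral_add (integrable_reward _ h) hint.integral_compProd

theorem integral_bellmanErr (G : M.GreedyRule F) (hB : M.IsBoundedClass F)
    (hC : M.BellmanComplete F) {f : QFun S A} (hf : f ∈ M.fnClass F) (π : Policy S A) {h : ℕ}
    (hh : h < M.H) :
    ∫ x, M.bellmanErr f h x ∂(M.occ π h) = ∫ x, f h x ∂(M.occ π h) - ∫ x, M.R h x ∂(M.occ π h) -
      ∫ s, maxVal (f (h + 1)) s ∂(M.stateLaw π (h + 1)) := by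
  unfold bellmanErr
  rw [integral_sub (integrable_fnClass hB hf h _) (integrable_bellman hB hC hf hh _),
    integral_bellman G hB hf]
  ring

theorem integral_maxVal_stateLaw_zero (G : M.GreedyRule F) (hB : M.IsBoundedClass F)
    {f : QFun S A} (hf : f ∈ M.fnClass F) (π : Policy S A) :
    ∫ s, maxVal (f 0) s ∂(M.stateLaw π 0) = maxVal (f 0) M.x₁ := by
  rw [stateLaw_zero, integral_dirac' _ _ (measurable_maxVal G hB hf 0).stronglyMeasurable]

theorem integral_occ_le (G : M.GreedyRule F) (hB : M.IsBoundedClass F) {f : QFun S A}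
    (hf : f ∈ M.fnClass F) (π : Policy S A) (h : ℕ) :
    ∫ x, f h x ∂(M.occ π h) ≤ ∫ s, maxVal (f h) s ∂(M.stateLaw π h) := by
  have h1 : M.stateLaw π h = (M.occ π h).fst := by
    rw [occ_eq_compProd, Measure.fst_compProd]
  rw [h1, Measure.fst, integral_map measurable_fst.aemeasurable
    (measurable_maxVal G hB hf h).aestronglyMeasurable]
  refine integral_mono (integrable_fnClass hB hf h _) ?_ (le_maxVal hB hf h)
  exact integrable_of_Icc ((measurable_maxVal G hB hf h).comp measurable_fst)
    (fun x => maxVal_mem_Icc G hB hf h x.1)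

theorem integral_occ_greedy (G : M.GreedyRule F) (hB : M.IsBoundedClass F) {f : QFun S A}
    (hf : f ∈ M.fnClass F) (h : ℕ) :
    ∫ x, f h x ∂(M.occ (G.policy f) h) = ∫ s, maxVal (f h) s ∂(M.stateLaw (G.policy f) h) := by
  rw [GreedyRule.policy, stateLaw_ofFun_occ, integral_map
    (measurable_id'.prodMk (G.measurable_act f h)).aemeasurable
    (measurable_of_mem_fnClass hB hf h).aestronglyMeasurable]
  exact integral_congr_ae (ae_of_all _ fun s => (maxVal_eq G hB hf h s).symm)

theorem sum_sub_telescope (G : M.GreedyRule F) (hB : M.IsBoundedClass F) {f : QFun S A}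
    (hf : f ∈ M.fnClass F) (π : Policy S A) :
    ∑ h ∈ Finset.range M.H, (∫ s, maxVal (f h) s ∂(M.stateLaw π h) -
      ∫ s, maxVal (f (h + 1)) s ∂(M.stateLaw π (h + 1))) = maxVal (f 0) M.x₁ := by
  rw [Finset.sum_range_sub' (fun h => ∫ s, maxVal (f h) s ∂(M.stateLaw π h)),
    integral_maxVal_stateLaw_zero G hB hf, hf.2 M.H le_rfl]
  simp [maxVal_zero]

/-- Summing the Bellman errors telescopes up to the loss from replacing `f h (s, a)` by the maximum
over actions. That loss has a sign for every policy and vanishes for the greedy one. Applied to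
`optQ`, whose Bellman errors are zero, it bounds the optimal value. -/
theorem value_le_sub_sum (G : M.GreedyRule F) (hB : M.IsBoundedClass F)
    (hC : M.BellmanComplete F) {f : QFun S A} (hf : f ∈ M.fnClass F) (π : Policy S A) :
    M.value π ≤ maxVal (f 0) M.x₁ -
      ∑ h ∈ Finset.range M.H, ∫ x, M.bellmanErr f h x ∂(M.occ π h) := by
  rw [← sum_sub_telescope G hB hf π, ← Finset.sum_sub_distrib, value_eq_sum]
  refine Finset.sum_le_sum fun h hh => ?_
  rw [integral_bellmanErr G hB hC hf π (Finset.mem_range.1 hh)]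
  linarith [integral_occ_le G hB hf π h]

/-- The Bellman error decomposition of the value of a greedy policy. -/
theorem value_greedy (G : M.GreedyRule F) (hB : M.IsBoundedClass F)
    (hC : M.BellmanComplete F) {f : QFun S A} (hf : f ∈ M.fnClass F) :
    M.value (G.policy f) = maxVal (f 0) M.x₁ -
      ∑ h ∈ Finset.range M.H, ∫ x, M.bellmanErr f h x ∂(M.occ (G.policy f) h) := by
  rw [← sum_sub_telescope G hB hf (G.policy f), ← Finset.sum_sub_distrib, value_eq_sum]
  refine Finset.sum_congr rfl fun h hh => ?_
  rw [integral_bellmanErr G hB hC hf _ (Finset.mem_range.1 hh), integral_occ_greedy G hB hf h]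
  ring

theorem optValue_le (G : M.GreedyRule F) (hB : M.IsBoundedClass F) (hC : M.BellmanComplete F) :
    M.optValue ≤ maxVal (M.optQ 0) M.x₁ := by
  have : Nonempty (Policy S A) := ⟨G.policy (fun _ _ => 0)⟩
  refine ciSup_le fun π => ?_
  have h1 := value_le_sub_sum G hB hC (optQ_mem_fnClass hC) π
  rw [Finset.sum_eq_zero, sub_zero] at h1
  · exact h1
  · intro h hh
    simp [bellmanErr_optQ (Finset.mem_range.1 hh)]

variable (M) in
theorem value_nonneg (π : Policy S A) : 0 ≤ M.value π :=
  integral_nonneg fun _ => Finset.sum_nonneg fun _ _ => (M.R_mem _ _).1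

end

/-! ### Exponential moments of the excess loss of one episode. -/

section

/-- By `exp x ≤ 1 + x + x²` for `|x| ≤ 1`, the moment of `exp(-lam X)` is at most `1 - lam m + lam²
K m ≤ 1 - lam m / 2 ≤ exp(-lam m / 2)`. Half of the mean pays for the second moment, which is why
the centering is at `m / 2`; the resulting deviation bound has no square root. -/
theorem lintegral_exp_centered_le_one {Ω : Type*} [MeasurableSpace Ω] {ν : Measure Ω}
    [IsProbabilityMeasure ν] {X : Ω → ℝ} (hX : Measurable X) {b K lam : ℝ} (hb : ∀ ω, |X ω| ≤ b)
    (hK : ∫ ω, X ω ^ 2 ∂ν ≤ K * ∫ ω, X ω ∂ν) (hm : 0 ≤ ∫ ω, X ω ∂ν)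
    (hlam : 0 ≤ lam) (hlb : lam * b ≤ 1) (hlK : lam * K ≤ 1 / 2) :
    ∫⁻ ω, ENNReal.ofReal (Real.exp (lam * ((∫ ω', X ω' ∂ν) / 2 - X ω))) ∂ν ≤ 1 := by
  set m := ∫ ω, X ω ∂ν with hm_def
  have hsmall : ∀ ω, |-(lam * X ω)| ≤ 1 := fun ω => by
    rw [abs_neg, abs_mul, abs_of_nonneg hlam]
    exact (mul_le_mul_of_nonneg_left (hb ω) hlam).trans hlb
  have hpt : ∀ ω, Real.exp (lam * (m / 2 - X ω)) ≤
      Real.exp (lam * m / 2) * (1 - lam * X ω + lam ^ 2 * X ω ^ 2) := fun ω => by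
    rw [show lam * (m / 2 - X ω) = lam * m / 2 + -(lam * X ω) by ring, Real.exp_add]
    refine mul_le_mul_of_nonneg_left ?_ (Real.exp_pos _).le
    have := (abs_le.1 (Real.abs_exp_sub_one_sub_id_le (hsmall ω))).2
    nlinarith [this]
  have hXi : Integrable X ν := integrable_of_Icc hX (fun ω => abs_le.1 (hb ω))
  have hX2 : Integrable (fun ω => X ω ^ 2) ν :=
    integrable_of_Icc (a := 0) (b := b ^ 2) (hX.pow_const 2)
      (fun ω => ⟨sq_nonneg _, sq_le_sq' (abs_le.1 (hb ω)).1 (abs_le.1 (hb ω)).2⟩)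
  have hlin : Integrable (fun ω => 1 - lam * X ω) ν := (integrable_const 1).sub (hXi.const_mul lam)
  have hdom : Integrable (fun ω => Real.exp (lam * m / 2) *
      (1 - lam * X ω + lam ^ 2 * X ω ^ 2)) ν :=
    (hlin.add (hX2.const_mul (lam ^ 2))).const_mul _
  have hint : Integrable (fun ω => Real.exp (lam * (m / 2 - X ω))) ν := by
    refine hdom.mono' (by fun_prop) (ae_of_all _ fun ω => ?_)
    rw [Real.norm_of_nonneg (Real.exp_pos _).le]
    exact hpt ω
  rw [← ofReal_integral_eq_lintegral_ofReal hint (ae_of_all _ fun ω => (Real.exp_pos _).le)]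
  refine ENNReal.ofReal_le_one.2 ((integral_mono hint hdom hpt).trans ?_)
  rw [integral_const_mul, integral_add hlin
    (hX2.const_mul (lam ^ 2)), integral_sub (integrable_const 1) (hXi.const_mul lam),
    integral_const_mul, integral_const_mul, ← hm_def]
  simp only [integral_const, probReal_univ, smul_eq_mul, mul_one]
  have h1 : 1 - lam * m + lam ^ 2 * ∫ ω, X ω ^ 2 ∂ν ≤ Real.exp (-(lam * m / 2)) := by
    have h2 := Real.add_one_le_exp (-(lam * m / 2))
    have h3 : lam ^ 2 * ∫ ω, X ω ^ 2 ∂ν ≤ lam * m / 2 :=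
      calc lam ^ 2 * ∫ ω, X ω ^ 2 ∂ν ≤ lam ^ 2 * (K * m) :=
            mul_le_mul_of_nonneg_left hK (sq_nonneg _)
        _ = lam * K * (lam * m) := by ring
        _ ≤ 1 / 2 * (lam * m) := mul_le_mul_of_nonneg_right hlK (mul_nonneg hlam hm)
        _ = lam * m / 2 := by ring
    linarith
  calc _ ≤ Real.exp (lam * m / 2) * Real.exp (-(lam * m / 2)) :=
        mul_le_mul_of_nonneg_left h1 (Real.exp_pos _).le
    _ = 1 := by rw [← Real.exp_add, add_neg_cancel, Real.exp_zero]

variable {M : MDP S A} {F : ℕ → Set (S × A → ℝ)}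

variable (M) in
/-- The excess loss of `f_h` over the Bellman backup of `f_{h+1}` on one transition. -/
def excess (f : QFun S A) (h : ℕ) (z : Transition S A) : ℝ :=
  M.transLoss h (f h) (f (h + 1)) z - M.transLoss h (M.bellman h (f (h + 1))) (f (h + 1)) z

/-- A difference of two squares with the same target: one factor is the Bellman error, the other is
bounded by `4 H`. Hence both the mean and the second moment are governed by the squared Bellman
error. -/
theorem excess_eq (f : QFun S A) (h : ℕ) (z : Transition S A) :
    M.excess f h z = M.bellmanErr f h z.1 *
      (f h z.1 + M.bellman h (f (h + 1)) z.1 - 2 * M.R h z.1 - 2 * maxVal (f (h + 1)) z.2) := by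
  simp only [excess, transLoss, bellmanErr, maxVal]
  ring

theorem measurable_bellmanErr (hB : M.IsBoundedClass F) (hC : M.BellmanComplete F) {f : QFun S A}
    (hf : f ∈ M.fnClass F) {h : ℕ} (hh : h < M.H) : Measurable (M.bellmanErr f h) :=
  (measurable_of_mem_fnClass hB hf h).sub (hB h hh _ (bellman_mem hC hf hh)).1

theorem measurable_excess (G : M.GreedyRule F) (hB : M.IsBoundedClass F)
    (hC : M.BellmanComplete F) {f : QFun S A} (hf : f ∈ M.fnClass F) {h : ℕ} (hh : h < M.H) :
    Measurable (M.excess f h) := by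
  rw [funext (excess_eq f h)]
  have h1 := measurable_bellmanErr hB hC hf hh
  have h2 := measurable_of_mem_fnClass hB hf h
  have h3 := (hB h hh _ (bellman_mem hC hf hh)).1
  have h4 := M.measurable_R h
  have h5 := measurable_maxVal G hB hf (h + 1)
  exact (h1.comp measurable_fst).mul ((((h2.comp measurable_fst).add (h3.comp measurable_fst)).sub
    ((h4.comp measurable_fst).const_mul 2)).sub ((h5.comp measurable_snd).const_mul 2))

theorem abs_bellmanErr_le (hB : M.IsBoundedClass F) (hC : M.BellmanComplete F) {f : QFun S A}
    (hf : f ∈ M.fnClass F) {h : ℕ} (hh : h < M.H) (x : S × A) : |M.bellmanErr f h x| ≤ M.H := by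
  have h1 := mem_Icc_of_mem_fnClass hB hf h x
  have h2 := (hB h hh _ (bellman_mem hC hf hh)).2 x
  rw [bellmanErr, abs_le]
  constructor <;> linarith [h1.1, h1.2, h2.1, h2.2]

theorem one_le_horizon {h : ℕ} (hh : h < M.H) : (1 : ℝ) ≤ M.H := by
  exact_mod_cast Nat.succ_le_of_lt (Nat.zero_lt_of_lt hh)

theorem abs_excess_factor_le (G : M.GreedyRule F) (hB : M.IsBoundedClass F)
    (hC : M.BellmanComplete F) {f : QFun S A} (hf : f ∈ M.fnClass F) {h : ℕ} (hh : h < M.H)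
    (z : Transition S A) :
    |f h z.1 + M.bellman h (f (h + 1)) z.1 - 2 * M.R h z.1 - 2 * maxVal (f (h + 1)) z.2| ≤
      4 * M.H := by
  have h1 := mem_Icc_of_mem_fnClass hB hf h z.1
  have h2 := (hB h hh _ (bellman_mem hC hf hh)).2 z.1
  have h3 := M.R_mem h z.1
  have h4 := maxVal_mem_Icc G hB hf (h + 1) z.2
  have h5 := one_le_horizon hh
  rw [abs_le]
  constructor <;> linarith [h1.1, h1.2, h2.1, h2.2, h3.1, h3.2, h4.1, h4.2]

theorem abs_excess_le_mul (G : M.GreedyRule F) (hB : M.IsBoundedClass F)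
    (hC : M.BellmanComplete F) {f : QFun S A} (hf : f ∈ M.fnClass F) {h : ℕ} (hh : h < M.H)
    (z : Transition S A) : |M.excess f h z| ≤ |M.bellmanErr f h z.1| * (4 * M.H) := by
  rw [excess_eq, abs_mul]
  exact mul_le_mul_of_nonneg_left (abs_excess_factor_le G hB hC hf hh z) (abs_nonneg _)

theorem abs_excess_le (G : M.GreedyRule F) (hB : M.IsBoundedClass F)
    (hC : M.BellmanComplete F) {f : QFun S A} (hf : f ∈ M.fnClass F) {h : ℕ} (hh : h < M.H)
    (z : Transition S A) : |M.excess f h z| ≤ 4 * (M.H : ℝ) ^ 2 :=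
  (abs_excess_le_mul G hB hC hf hh z).trans <| by
    nlinarith [abs_bellmanErr_le hB hC hf hh z.1, one_le_horizon hh]

/-- The mean squared Bellman error of `f` at step `h` under the policy `π`. -/
def meanSqErr (M : MDP S A) (π : Policy S A) (f : QFun S A) (h : ℕ) : ℝ :=
  ∫ x, M.bellmanErr f h x ^ 2 ∂(M.occ π h)

theorem meanSqErr_nonneg (π : Policy S A) (f : QFun S A) (h : ℕ) : 0 ≤ M.meanSqErr π f h :=
  integral_nonneg fun _ => sq_nonneg _

theorem sq_bellmanErr_mem_Icc (hB : M.IsBoundedClass F) (hC : M.BellmanComplete F) {f : QFun S A}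
    (hf : f ∈ M.fnClass F) {h : ℕ} (hh : h < M.H) (x : S × A) :
    M.bellmanErr f h x ^ 2 ∈ Set.Icc 0 ((M.H : ℝ) ^ 2) :=
  have hb := abs_le.1 (abs_bellmanErr_le hB hC hf hh x)
  ⟨sq_nonneg _, sq_le_sq' hb.1 hb.2⟩

theorem integrable_sq_bellmanErr (hB : M.IsBoundedClass F) (hC : M.BellmanComplete F)
    {f : QFun S A} (hf : f ∈ M.fnClass F) {h : ℕ} (hh : h < M.H) (μ : Measure (S × A))
    [IsFiniteMeasure μ] : Integrable (fun x => M.bellmanErr f h x ^ 2) μ :=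
  integrable_of_Icc ((measurable_bellmanErr hB hC hf hh).pow_const 2)
    (sq_bellmanErr_mem_Icc hB hC hf hh)

theorem integral_excess (G : M.GreedyRule F) (hB : M.IsBoundedClass F)
    (hC : M.BellmanComplete F) {f : QFun S A} (hf : f ∈ M.fnClass F) {h : ℕ} (hh : h < M.H)
    (π : Policy S A) :
    ∫ z, M.excess f h z ∂(M.occ π h ⊗ₘ M.P h) = M.meanSqErr π f h := by
  have hint : Integrable (M.excess f h) (M.occ π h ⊗ₘ M.P h) :=
    integrable_of_Icc (measurable_excess G hB hC hf hh)
      (fun z => abs_le.1 (abs_excess_le G hB hC hf hh z))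
  rw [Measure.integral_compProd hint]
  refine integral_congr_ae (ae_of_all _ fun x => ?_)
  have hV := integrable_maxVal G hB hf (h + 1) (M.P h x)
  simp only [excess_eq]
  rw [integral_const_mul, integral_sub (integrable_const _) (hV.const_mul 2), integral_const_mul]
  -- Given `(s, a)`, the target has mean `𝒯_h f_{h+1}`, so the second factor averages to `f_h - 𝒯_h
  -- f_{h+1}`, the Bellman error itself.
  have : ∫ s, maxVal (f (h + 1)) s ∂(M.P h x) = M.bellman h (f (h + 1)) x - M.R h x := by
    simp [bellman, maxVal]
  rw [this]
  simp only [integral_const, probReal_univ, smul_eq_mul, bellmanErr]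
  ring

theorem integral_sq_excess_le (G : M.GreedyRule F) (hB : M.IsBoundedClass F)
    (hC : M.BellmanComplete F) {f : QFun S A} (hf : f ∈ M.fnClass F) {h : ℕ} (hh : h < M.H)
    (π : Policy S A) :
    ∫ z, M.excess f h z ^ 2 ∂(M.occ π h ⊗ₘ M.P h) ≤ 16 * (M.H : ℝ) ^ 2 * M.meanSqErr π f h := by
  have hfst : ∫ z, M.bellmanErr f h z.1 ^ 2 ∂(M.occ π h ⊗ₘ M.P h) = M.meanSqErr π f h := by
    have h1 : M.occ π h = (M.occ π h ⊗ₘ M.P h).fst := by simp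
    rw [meanSqErr]
    conv_rhs => rw [h1]
    rw [Measure.fst, integral_map measurable_fst.aemeasurable
      ((measurable_bellmanErr hB hC hf hh).pow_const 2).aestronglyMeasurable]
  rw [← hfst, ← integral_const_mul]
  have hle : ∀ z, M.excess f h z ^ 2 ≤ 16 * (M.H : ℝ) ^ 2 * M.bellmanErr f h z.1 ^ 2 := fun z => by
    have := pow_le_pow_left₀ (abs_nonneg _) (abs_excess_le_mul G hB hC hf hh z) 2
    rw [mul_pow, sq_abs, sq_abs] at this
    linarith
  refine integral_mono_of_nonneg (ae_of_all _ fun z => sq_nonneg _) (Integrable.const_mul ?_ _)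
    (ae_of_all _ hle)
  exact integrable_of_Icc (((measurable_bellmanErr hB hC hf hh).comp measurable_fst).pow_const 2)
    (fun z => sq_bellmanErr_mem_Icc hB hC hf hh z.1)

variable (M) in
/-- The exponential weight of one episode, drawn from the policy `π`. -/
def expWeight (f : QFun S A) (h : Fin M.H) (π : Policy S A) (e : M.Episode) : ℝ≥0∞ :=
  ENNReal.ofReal (Real.exp
    ((32 * (M.H : ℝ) ^ 2)⁻¹ * (M.meanSqErr π f h / 2 - M.excess f h (e h))))

theorem lintegral_expWeight_le_one (G : M.GreedyRule F) (hB : M.IsBoundedClass F)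
    (hC : M.BellmanComplete F) {f : QFun S A} (hf : f ∈ M.fnClass F) (h : Fin M.H)
    (π : Policy S A) : ∫⁻ e, M.expWeight f h π e ∂(M.trajLaw π M.H) ≤ 1 := by
  have hm := measurable_excess G hB hC hf h.isLt
  have hH : (0 : ℝ) < (M.H : ℝ) ^ 2 := by
    have := one_le_horizon h.isLt
    positivity
  have hmap := M.map_eval_trajLaw π M.H h
  have h1 := lintegral_exp_centered_le_one (ν := M.occ π h ⊗ₘ M.P h) hm
    -- `lam = 1 / (2 K)` makes `lam * K = 1 / 2`, and `lam` times the bound `4 H²` is `1 / 8`.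
    (abs_excess_le G hB hC hf h.isLt) (K := 16 * (M.H : ℝ) ^ 2) (lam := (32 * (M.H : ℝ) ^ 2)⁻¹)
    (by rw [integral_excess G hB hC hf h.isLt]; exact integral_sq_excess_le G hB hC hf h.isLt π)
    (by rw [integral_excess G hB hC hf h.isLt]; exact meanSqErr_nonneg π f h)
    (by positivity) (by rw [inv_mul_le_iff₀ (by positivity)]; linarith)
    (by rw [inv_mul_le_iff₀ (by positivity)]; linarith)
  rw [integral_excess G hB hC hf h.isLt, ← hmap, lintegral_map (by fun_prop)
    (measurable_pi_apply _)] at h1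
  exact h1

end

/-! ### The law of the run and the exponential weights along it. -/

section

theorem stepKernel_ofFun (M : MDP S A) (g : ℕ → S → A) (hg : ∀ h, Measurable (g h)) (n : ℕ)
    (s : S) : M.stepKernel (Policy.ofFun g hg) n s =
      (M.P n (s, g n s)).map (fun s' => ((s, g n s), s')) := by
  rw [stepKernel, Kernel.comp_apply, Kernel.prod_apply]
  simp only [Policy.ofFun, Kernel.id_apply, Kernel.deterministic_apply]
  rw [Measure.dirac_prod_dirac, Measure.dirac_bind (Kernel.measurable _), Kernel.prod_apply,
    Kernel.id_apply, Measure.dirac_prod]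

/-- The choice `sel` need not be measurable; only the played action is, jointly in data and state.
This suffices for episode laws to form a kernel: with a deterministic policy only the next state is
random, so each step integrates a jointly measurable section. -/
theorem measurable_trajLaw_ofFun (M : MDP S A) {Ω : Type*} [MeasurableSpace Ω]
    (g : Ω → ℕ → S → A) (hg : ∀ ω h, Measurable (g ω h))
    (hjoint : ∀ h < M.H, Measurable fun p : Ω × S => g p.1 h p.2) (n : ℕ) (hn : n ≤ M.H) :
    Measurable fun ω => M.trajLaw (Policy.ofFun (g ω) (hg ω)) n := by
  induction n with
  | zero => exact measurable_const
  | succ n ih =>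
    let κ : Kernel Ω (Fin n → Transition S A) :=
      ⟨fun ω => M.trajLaw (Policy.ofFun (g ω) (hg ω)) n, ih (by omega)⟩
    have : IsMarkovKernel κ := ⟨fun ω => M.isProbabilityMeasure_trajLaw _ n⟩
    let sa : Ω × (Fin n → Transition S A) → S × A :=
      fun p => (curState M.x₁ n p.2, g p.1 n (curState M.x₁ n p.2))
    have hcur : Measurable fun p : Ω × (Fin n → Transition S A) => curState M.x₁ n p.2 :=
      (measurable_curState M.x₁ n).comp measurable_snd
    have hsa : Measurable sa := hcur.prodMk ((hjoint n hn).comp (measurable_fst.prodMk hcur))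
    refine Measure.measurable_of_measurable_coe _ fun B hB => ?_
    have hB' := measurable_snoc (E := Transition S A) n hB
    let T : Set ((Ω × (Fin n → Transition S A)) × S) :=
      {q | (Fin.snoc q.1.2 (sa q.1, q.2) : Fin (n + 1) → Transition S A) ∈ B}
    have hT : MeasurableSet T :=
      ((measurable_snoc n).comp ((measurable_snd.comp measurable_fst).prodMk
        ((hsa.comp measurable_fst).prodMk measurable_snd))) hB
    have hfun : Measurable fun p => ((M.P n).comap sa hsa) p (Prod.mk p ⁻¹' T) :=
      Kernel.measurable_kernel_prodMk_left hT
    have hkey : ∀ ω, M.trajLaw (Policy.ofFun (g ω) (hg ω)) (n + 1) B =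
        ∫⁻ τ, ((M.P n).comap sa hsa) (ω, τ) (Prod.mk (ω, τ) ⁻¹' T) ∂(κ ω) := by
      intro ω
      rw [trajLaw, Measure.map_apply (measurable_snoc n) hB, Measure.compProd_apply hB']
      refine lintegral_congr fun τ => ?_
      rw [Kernel.comap_apply, stepKernel_ofFun, Measure.map_apply (by fun_prop)
        (measurable_prodMk_left hB')]
      rfl
    simp_rw [hkey]
    exact hfun.lintegral_kernel_prod_right'

variable {M : MDP S A} {F : ℕ → Set (S × A → ℝ)} {G : M.GreedyRule F} {w : ℝ} {warm : Bool}
  {Noff Non : ℕ} {sel : (t : ℕ) → M.History Noff t → QFun S A}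

/-- Appends one online episode to the data. -/
def History.append {t : ℕ} (D : M.History Noff t) (e : M.Episode) : M.History Noff (t + 1) :=
  (D.1, Fin.snoc D.2 e)

theorem History.measurable_append {t : ℕ} :
    Measurable fun p : M.History Noff t × M.Episode => History.append p.1 p.2 :=
  (measurable_fst.comp measurable_fst).prodMk ((measurable_snoc t).comp
    ((measurable_snd.comp measurable_fst).prodMk measurable_snd))

theorem measurable_episodeLaw (hsel : M.IsDiscGolf G w warm Noff Non sel) {t : ℕ} (ht : t < Non) :
    Measurable fun D : M.History Noff t => M.trajLaw (G.policy (sel t D)) M.H :=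
  measurable_trajLaw_ofFun M (fun D => G.act (sel t D)) (fun _ => G.measurable_act _)
    (hsel.measurable_play t ht) M.H le_rfl

/-- The law of the next online episode, given the data so far. -/
def episodeKernel (hsel : M.IsDiscGolf G w warm Noff Non sel) {t : ℕ} (ht : t < Non) :
    Kernel (M.History Noff t) M.Episode :=
  ⟨fun D => M.trajLaw (G.policy (sel t D)) M.H, measurable_episodeLaw hsel ht⟩

instance isMarkovKernel_episodeKernel (hsel : M.IsDiscGolf G w warm Noff Non sel) {t : ℕ}
    (ht : t < Non) : IsMarkovKernel (episodeKernel hsel ht) :=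
  ⟨fun _ => M.isProbabilityMeasure_trajLaw _ _⟩

/-- Rewrites the `bind` as a composition product, for which conditioning on the past is Fubini's
theorem. -/
theorem runLaw_succ (hsel : M.IsDiscGolf G w warm Noff Non sel) (πoff : Policy S A) {t : ℕ}
    (ht : t < Non) [SFinite (M.runLaw G πoff sel t)] : M.runLaw G πoff sel (t + 1) =
      (M.runLaw G πoff sel t ⊗ₘ episodeKernel hsel ht).map fun p => History.append p.1 p.2 := by
  have hmeas : ∀ D : M.History Noff t, Measurable fun e : M.Episode => History.append D e :=
    fun D => History.measurable_append.comp measurable_prodMk_left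
  have hker : Measurable fun D : M.History Noff t =>
      (M.trajLaw (G.policy (sel t D)) M.H).map fun e => History.append D e := by
    refine Measure.measurable_of_measurable_coe _ fun B hB => ?_
    have : ∀ D : M.History Noff t,
        (M.trajLaw (G.policy (sel t D)) M.H).map (fun e => History.append D e) B =
        episodeKernel hsel ht D (Prod.mk D ⁻¹' ((fun p => History.append p.1 p.2) ⁻¹' B)) :=
      fun D => by rw [Measure.map_apply (hmeas D) hB]; rfl
    simp_rw [this]
    exact Kernel.measurable_kernel_prodMk_left (History.measurable_append hB)
  ext B hB
  rw [Measure.map_apply History.measurable_append hB,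
    Measure.compProd_apply (History.measurable_append hB), runLaw]
  refine (Measure.bind_apply hB hker.aemeasurable).trans (lintegral_congr fun D => ?_)
  rw [Measure.map_apply (hmeas D) hB]
  rfl

theorem isProbabilityMeasure_runLaw (hsel : M.IsDiscGolf G w warm Noff Non sel)
    (πoff : Policy S A) {t : ℕ} (ht : t ≤ Non) :
    IsProbabilityMeasure (M.runLaw G πoff sel t) := by
  induction t with
  | zero =>
    unfold runLaw
    exact Measure.isProbabilityMeasure_map (by fun_prop)
  | succ t ih =>
    have := ih (by omega)
    rw [runLaw_succ hsel πoff ht]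
    exact Measure.isProbabilityMeasure_map History.measurable_append.aemeasurable

/-- The data available after the first `t` online episodes. -/
def History.restrict {T : ℕ} (t : ℕ) (h : t ≤ T) (D : M.History Noff T) : M.History Noff t :=
  (D.1, fun i => D.2 (Fin.castLE h i))

theorem History.measurable_restrict {t T : ℕ} (h : t ≤ T) :
    Measurable (History.restrict (M := M) (Noff := Noff) t h) := by
  unfold History.restrict
  fun_prop

theorem map_restrict_runLaw (hsel : M.IsDiscGolf G w warm Noff Non sel)
    (πoff : Policy S A) {t T : ℕ} (htT : t ≤ T) (hT : T ≤ Non) :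
    (M.runLaw G πoff sel T).map (History.restrict t htT) = M.runLaw G πoff sel t := by
  induction T, htT using Nat.le_induction with
  | base => exact Measure.map_id
  | succ T htT ih =>
    have := isProbabilityMeasure_runLaw hsel πoff (t := T) (by omega)
    conv_rhs => rw [← ih (by omega)]
    have h1 : M.runLaw G πoff sel T = (M.runLaw G πoff sel T ⊗ₘ episodeKernel hsel hT).fst := by
      simp
    conv_rhs => rw [h1]
    rw [runLaw_succ hsel πoff hT, Measure.fst,
      Measure.map_map (History.measurable_restrict _) measurable_fst,
      Measure.map_map (History.measurable_restrict _) History.measurable_append]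
    congr 1
    ext p : 1
    refine Prod.ext rfl (funext fun i => ?_)
    exact Fin.snoc_castSucc (α := fun _ => M.Episode) p.2 p.1.2 (Fin.castLE htT i)

/-- The exponential weight of all the data after `t` online episodes. -/
def runWeight (G : M.GreedyRule F) (πoff : Policy S A) (sel : (t : ℕ) → M.History Noff t → QFun S A)
    (f : QFun S A) (h : Fin M.H) {t : ℕ} (D : M.History Noff t) : ℝ≥0∞ :=
  (∏ i : Fin Noff, M.expWeight f h πoff (D.1 i)) *
    ∏ i : Fin t, M.expWeight f h (G.policy (sel i (History.upTo D i))) (D.2 i)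

theorem runWeight_append (πoff : Policy S A) (f : QFun S A) (h : Fin M.H) {t : ℕ}
    (D : M.History Noff t) (e : M.Episode) :
    runWeight G πoff sel f h (D.append e) =
      runWeight G πoff sel f h D * M.expWeight f h (G.policy (sel t D)) e := by
  unfold runWeight
  rw [Fin.prod_univ_castSucc, mul_assoc]
  have h1 : ∀ i : Fin t, History.upTo (D.append e) i.castSucc = History.upTo D i := fun i =>
    Prod.ext rfl (funext fun j => Fin.snoc_castSucc (α := fun _ => M.Episode) e D.2
      (Fin.castLE i.isLt.le j))
  have h2 : History.upTo (D.append e) (Fin.last t) = D :=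
    Prod.ext rfl (funext fun j => Fin.snoc_castSucc (α := fun _ => M.Episode) e D.2 j)
  have h3 : ∀ i : Fin t, (D.append e).2 i.castSucc = D.2 i := fun i =>
    Fin.snoc_castSucc (α := fun _ => M.Episode) e D.2 i
  have h4 : (D.append e).2 (Fin.last t) = e :=
    Fin.snoc_last (α := fun _ => M.Episode) e D.2
  simp only [h1, h3, h4]
  congr 2
  simp only [Fin.val_last]
  rw [h2]

theorem measurable_occ_episode (hsel : M.IsDiscGolf G w warm Noff Non sel) {t : ℕ} (ht : t < Non)
    {h : ℕ} (hh : h < M.H) :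
    Measurable fun D : M.History Noff t => M.occ (G.policy (sel t D)) h :=
  (Measure.measurable_map _ (by fun_prop)).comp
    (measurable_trajLaw_ofFun M (fun D => G.act (sel t D)) (fun _ => G.measurable_act _)
      (hsel.measurable_play t ht) (h + 1) hh)

/-- For fixed `f`, the data enter only through the occupancy measure, which is a kernel in the data.
-/
theorem measurable_meanSqErr_episode (hsel : M.IsDiscGolf G w warm Noff Non sel)
    (hB : M.IsBoundedClass F) (hC : M.BellmanComplete F) {t : ℕ} (ht : t < Non)
    {f : QFun S A} (hf : f ∈ M.fnClass F) {h : ℕ} (hh : h < M.H) :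
    Measurable fun D : M.History Noff t => M.meanSqErr (G.policy (sel t D)) f h := by
  let κ : Kernel (M.History Noff t) (S × A) :=
    ⟨fun D => M.occ (G.policy (sel t D)) h, measurable_occ_episode hsel ht hh⟩
  have : IsMarkovKernel κ := ⟨fun _ => M.isProbabilityMeasure_occ _ _⟩
  exact (StronglyMeasurable.integral_kernel (κ := κ)
    ((measurable_bellmanErr hB hC hf hh).pow_const 2).stronglyMeasurable).measurable

theorem measurable_expWeight_episode (hsel : M.IsDiscGolf G w warm Noff Non sel)
    (hB : M.IsBoundedClass F) (hC : M.BellmanComplete F) {t : ℕ} (ht : t < Non)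
    {f : QFun S A} (hf : f ∈ M.fnClass F) (h : Fin M.H) :
    Measurable fun p : M.History Noff t × M.Episode =>
      M.expWeight f h (G.policy (sel t p.1)) p.2 := by
  have h1 := (measurable_meanSqErr_episode hsel hB hC ht hf h.isLt)
  have h2 := measurable_excess G hB hC hf h.isLt
  unfold expWeight
  exact (Real.measurable_exp.comp ((((h1.comp measurable_fst).div_const 2).sub
    (h2.comp ((measurable_pi_apply h).comp measurable_snd))).const_mul _)).ennreal_ofReal

theorem measurable_expWeight (G : M.GreedyRule F)
    (hB : M.IsBoundedClass F) (hC : M.BellmanComplete F)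
    {f : QFun S A} (hf : f ∈ M.fnClass F) (h : Fin M.H) (π : Policy S A) :
    Measurable (M.expWeight f h π) := by
  have h2 := measurable_excess G hB hC hf h.isLt
  unfold expWeight
  exact (Real.measurable_exp.comp (((h2.comp (measurable_pi_apply h)).const_sub _).const_mul
    _)).ennreal_ofReal

theorem measurable_runWeight (hsel : M.IsDiscGolf G w warm Noff Non sel)
    (hB : M.IsBoundedClass F) (hC : M.BellmanComplete F) (πoff : Policy S A) {t : ℕ} (ht : t ≤ Non)
    {f : QFun S A} (hf : f ∈ M.fnClass F) (h : Fin M.H) :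
    Measurable fun D : M.History Noff t => runWeight G πoff sel f h D := by
  have hoff : ∀ i : Fin Noff, Measurable fun D : M.History Noff t =>
      M.expWeight f h πoff (D.1 i) := fun i =>
    (measurable_expWeight G hB hC hf h πoff).comp ((measurable_pi_apply i).comp measurable_fst)
  have hon : ∀ i : Fin t, Measurable fun D : M.History Noff t =>
      M.expWeight f h (G.policy (sel i (History.upTo D i))) (D.2 i) := fun i => by
    have h1 := measurable_expWeight_episode hsel hB hC (i.isLt.trans_le ht) hf h
    have h2 : Measurable fun D : M.History Noff t => (History.upTo D i, D.2 i) :=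
      (History.measurable_restrict i.isLt.le).prodMk
        ((measurable_pi_apply i).comp measurable_snd)
    simpa only [Function.comp_def] using h1.comp h2
  have h1 : Measurable fun D : M.History Noff t => ∏ i : Fin Noff, M.expWeight f h πoff (D.1 i) :=
    Finset.measurable_fun_prod _ fun i _ => hoff i
  have h2 : Measurable fun D : M.History Noff t =>
      ∏ i : Fin t, M.expWeight f h (G.policy (sel i (History.upTo D i))) (D.2 i) :=
    Finset.measurable_fun_prod _ fun i _ => hon i
  exact h1.mul h2

theorem lintegral_runWeight_le_one (hsel : M.IsDiscGolf G w warm Noff Non sel)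
    (hB : M.IsBoundedClass F) (hC : M.BellmanComplete F) (πoff : Policy S A) {t : ℕ} (ht : t ≤ Non)
    {f : QFun S A} (hf : f ∈ M.fnClass F) (h : Fin M.H) :
    ∫⁻ D, runWeight G πoff sel f h D ∂(M.runLaw G πoff sel t) ≤ 1 := by
  induction t with
  | zero =>
    have hw := measurable_expWeight G hB hC hf h πoff
    rw [runLaw, lintegral_map (measurable_runWeight hsel hB hC πoff ht hf h) (by fun_prop)]
    simp only [runWeight, Finset.univ_eq_empty, Finset.prod_empty, mul_one]
    -- The offline episodes are independent, so the expectation of the product factors.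
    rw [lintegral_prod_eq_prod_lintegral_of_indepFun Finset.univ
      (fun i (D : Fin Noff → M.Episode) => M.expWeight f h πoff (D i))
      (iIndepFun_pi (X := fun _ => M.expWeight f h πoff) fun _ => hw.aemeasurable)
      (fun i => hw.comp (measurable_pi_apply i))]
    refine Finset.prod_le_one' fun i _ => ?_
    have h1 := (measurePreserving_eval (fun _ : Fin Noff => M.trajLaw πoff M.H) i).lintegral_comp hw
    simp only [Function.eval] at h1
    rw [h1]
    exact lintegral_expWeight_le_one G hB hC hf h πoff
  | succ t ih =>
    have := isProbabilityMeasure_runLaw hsel πoff (t := t) (by omega)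
    have hm := measurable_runWeight hsel hB hC πoff ht hf h
    rw [runLaw_succ hsel πoff ht, lintegral_map hm History.measurable_append,
      Measure.lintegral_compProd (by exact hm.comp History.measurable_append)]
    -- Supermartingale step: given the data, the next policy is fixed and the new factor has
    -- expectation at most 1.
    refine le_trans (lintegral_mono fun D => ?_) (ih (by omega))
    simp only [runWeight_append]
    rw [lintegral_const_mul _ (measurable_expWeight G hB hC hf h _)]
    exact mul_le_of_le_one_right' (lintegral_expWeight_le_one G hB hC hf h _)

/-- The weights of all `f` in a finite family, all steps and all rounds are small
simultaneously, with high probability. -/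
theorem runLaw_exists_weight_gt_le (hsel : M.IsDiscGolf G w warm Noff Non sel)
    (hB : M.IsBoundedClass F) (hC : M.BellmanComplete F) (πoff : Policy S A)
    (C : Finset (QFun S A)) (hCF : ∀ f ∈ C, f ∈ M.fnClass F) {a : ℝ≥0∞} (ha : a ≠ 0)
    (ha' : a ≠ ∞) :
    M.runLaw G πoff sel Non {D | ∃ t : Fin Non, ∃ h : Fin M.H, ∃ f ∈ C,
      a ≤ runWeight G πoff sel f h (History.upTo D t)} ≤ Non * M.H * C.card / a := by
  have hset : {D : M.History Noff Non | ∃ t : Fin Non, ∃ h : Fin M.H, ∃ f ∈ C,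
      a ≤ runWeight G πoff sel f h (History.upTo D t)} =
      ⋃ t : Fin Non, ⋃ h : Fin M.H, ⋃ f ∈ C,
        History.restrict t t.isLt.le ⁻¹' {D | a ≤ runWeight G πoff sel f h D} := by
    ext D
    simp only [Set.mem_ofPred_eq, Set.mem_iUnion, Set.mem_preimage, exists_prop]
    rfl
  have hone : ∀ (t : Fin Non) (h : Fin M.H), ∀ f ∈ C, M.runLaw G πoff sel Non
      (History.restrict t t.isLt.le ⁻¹' {D | a ≤ runWeight G πoff sel f h D}) ≤ 1 / a := by
    intro t h f hf
    have hm := measurable_runWeight hsel hB hC πoff t.isLt.le (hCF f hf) h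
    -- The weight of round `t` depends only on the first `t` episodes, so its tail can be computed
    -- under the law of the run stopped there.
    rw [← Measure.map_apply (History.measurable_restrict _) (measurableSet_le measurable_const hm),
      map_restrict_runLaw hsel πoff _ le_rfl]
    refine (meas_ge_le_lintegral_div hm.aemeasurable ha ha').trans ?_
    gcongr
    exact lintegral_runWeight_le_one hsel hB hC πoff t.isLt.le (hCF f hf) h
  rw [hset]
  calc _ ≤ ∑ t : Fin Non, ∑ h : Fin M.H, ∑ f ∈ C, 1 / a := by
        refine (measure_iUnion_fintype_le _ _).trans (Finset.sum_le_sum fun t _ => ?_)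
        refine (measure_iUnion_fintype_le _ _).trans (Finset.sum_le_sum fun h _ => ?_)
        exact (measure_biUnion_finset_le _ _).trans (Finset.sum_le_sum fun f hf => hone t h f hf)
    _ = Non * M.H * C.card / a := by
        simp only [Finset.sum_const, Finset.card_univ, Fintype.card_fin, nsmul_eq_mul]
        rw [div_eq_mul_inv, div_eq_mul_inv, one_mul, mul_assoc, mul_assoc]

end

/-! ### Covering, the concentration event, optimism and small Bellman errors. -/

section

variable {M : MDP S A} {F : ℕ → Set (S × A → ℝ)} {G : M.GreedyRule F} {w : ℝ} {warm : Bool}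
  {Noff Non : ℕ} {sel : (t : ℕ) → M.History Noff t → QFun S A}

/-- The covering number uses centers inside the set, so they pull back to members of the class. This
matters because the weights are controlled only for functions in the class. -/
theorem exists_finset_cover {ρ : ℝ≥0} (hρ : M.coverNum F ρ ≠ ⊤) :
    ∃ C : Finset (QFun S A), (∀ f ∈ C, f ∈ M.fnClass F) ∧ C.card ≤ (M.coverNum F ρ).toNat ∧
      ∀ f ∈ M.fnClass F, ∃ g ∈ C, ∀ h x, |f h x - g h x| ≤ ρ := by
  classical
  obtain ⟨C, hCsub, hCfin, hCcov, hCcard⟩ := Metric.exists_set_encard_eq_coveringNumber hρ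
  set φ := fun f : QFun S A => UniformFun.ofFun (fun p : ℕ × (S × A) => f p.1 p.2)
  have hinv : ∀ c ∈ C, Function.invFunOn φ (M.fnClass F) c ∈ M.fnClass F ∧
      φ (Function.invFunOn φ (M.fnClass F) c) = c := fun c hc => by
    obtain ⟨f, hf, rfl⟩ := hCsub hc
    exact ⟨Function.invFunOn_mem ⟨f, hf, rfl⟩, Function.invFunOn_eq ⟨f, hf, rfl⟩⟩
  refine ⟨hCfin.toFinset.image (Function.invFunOn φ (M.fnClass F)), ?_, ?_, ?_⟩
  · simp only [Finset.mem_image, Set.Finite.mem_toFinset]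
    rintro _ ⟨c, hc, rfl⟩
    exact (hinv c hc).1
  · refine Finset.card_image_le.trans ?_
    rw [coverNum, ← hCcard, hCfin.encard_eq_coe_toFinset_card]
    simp
  · intro f hf
    obtain ⟨c, hc, hdist⟩ := hCcov (Set.mem_image_of_mem φ hf)
    refine ⟨_, Finset.mem_image_of_mem _ (hCfin.mem_toFinset.2 hc), fun h x => ?_⟩
    have h1 : edist (φ f) (φ (Function.invFunOn φ (M.fnClass F) c)) ≤ ρ := by
      rw [(hinv c hc).2]
      exact hdist
    have h2 : edist (f h x) (Function.invFunOn φ (M.fnClass F) c h x) ≤ ρ :=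
      UniformFun.edist_le.1 h1 (h, x)
    rw [edist_nndist, ENNReal.coe_le_coe, ← NNReal.coe_le_coe, coe_nndist, Real.dist_eq] at h2
    exact h2

/-- Each maximum is compared with the value of the other function at the same maximizer. -/
theorem abs_maxVal_sub_le (G : M.GreedyRule F) (hB : M.IsBoundedClass F) {f g : QFun S A}
    (hf : f ∈ M.fnClass F) (hg : g ∈ M.fnClass F) {ρ : ℝ} (hfg : ∀ h x, |f h x - g h x| ≤ ρ)
    (h : ℕ) (s : S) : |maxVal (f h) s - maxVal (g h) s| ≤ ρ := by
  have h1 := maxVal_eq G hB hf h s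
  have h2 := maxVal_eq G hB hg h s
  have h3 := le_maxVal hB hg h (s, G.act f h s)
  have h4 := le_maxVal hB hf h (s, G.act g h s)
  have h5 := abs_le.1 (hfg h (s, G.act f h s))
  have h6 := abs_le.1 (hfg h (s, G.act g h s))
  simp only at h3 h4
  rw [abs_le]
  constructor <;> linarith [h5.1, h5.2, h6.1, h6.2]

theorem abs_bellman_sub_le (G : M.GreedyRule F) (hB : M.IsBoundedClass F) {f g : QFun S A}
    (hf : f ∈ M.fnClass F) (hg : g ∈ M.fnClass F) {ρ : ℝ} (hfg : ∀ h x, |f h x - g h x| ≤ ρ)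
    (h : ℕ) (x : S × A) : |M.bellman h (f (h + 1)) x - M.bellman h (g (h + 1)) x| ≤ ρ := by
  have h1 : M.bellman h (f (h + 1)) x - M.bellman h (g (h + 1)) x =
      ∫ s, (maxVal (f (h + 1)) s - maxVal (g (h + 1)) s) ∂(M.P h x) := by
    rw [integral_sub (integrable_maxVal G hB hf _ _) (integrable_maxVal G hB hg _ _)]
    simp only [bellman, maxVal]
    ring
  rw [h1]
  have h2 := norm_integral_le_of_norm_le_const (μ := M.P h x)
    (f := fun s => maxVal (f (h + 1)) s - maxVal (g (h + 1)) s)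
    (ae_of_all _ fun s => abs_maxVal_sub_le G hB hf hg hfg (h + 1) s)
  simpa using h2

theorem abs_bellmanErr_sub_le (G : M.GreedyRule F) (hB : M.IsBoundedClass F) {f g : QFun S A}
    (hf : f ∈ M.fnClass F) (hg : g ∈ M.fnClass F) {ρ : ℝ} (hfg : ∀ h x, |f h x - g h x| ≤ ρ)
    (h : ℕ) (x : S × A) : |M.bellmanErr f h x - M.bellmanErr g h x| ≤ 2 * ρ := by
  have h1 := abs_le.1 (hfg h x)
  have h2 := abs_le.1 (abs_bellman_sub_le G hB hf hg hfg h x)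
  simp only [bellmanErr]
  rw [abs_le]
  constructor <;> linarith [h1.1, h1.2, h2.1, h2.2]

theorem abs_excess_sub_le (G : M.GreedyRule F) (hB : M.IsBoundedClass F)
    (hC : M.BellmanComplete F) {f g : QFun S A}
    (hf : f ∈ M.fnClass F) (hg : g ∈ M.fnClass F) {ρ : ℝ} (hfg : ∀ h x, |f h x - g h x| ≤ ρ)
    {h : ℕ} (hh : h < M.H) (z : Transition S A) :
    |M.excess f h z - M.excess g h z| ≤ 12 * M.H * ρ := by
  have hV := abs_maxVal_sub_le G hB hf hg hfg (h + 1) z.2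
  have hT := abs_bellman_sub_le G hB hf hg hfg h z.1
  have hE := abs_bellmanErr_sub_le G hB hf hg hfg h z.1
  have hfac := abs_excess_factor_le G hB hC hf hh z
  have hEg := abs_bellmanErr_le hB hC hg hh z.1
  have hρ : 0 ≤ ρ := (abs_nonneg _).trans hV
  have hH : (0 : ℝ) ≤ M.H := Nat.cast_nonneg _
  rw [excess_eq, excess_eq]
  set a := f h z.1 + M.bellman h (f (h + 1)) z.1 - 2 * M.R h z.1 - 2 * maxVal (f (h + 1)) z.2
  set b := g h z.1 + M.bellman h (g (h + 1)) z.1 - 2 * M.R h z.1 - 2 * maxVal (g (h + 1)) z.2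
  have hab : |a - b| ≤ 4 * ρ := by
    have h1 := abs_le.1 (hfg h z.1)
    rw [abs_le] at hV hT ⊢
    constructor <;> simp only [a, b] <;> linarith [h1.1, h1.2, hV.1, hV.2, hT.1, hT.2]
  calc |M.bellmanErr f h z.1 * a - M.bellmanErr g h z.1 * b|
      = |(M.bellmanErr f h z.1 - M.bellmanErr g h z.1) * a + M.bellmanErr g h z.1 * (a - b)| := by
        ring_nf
    _ ≤ |M.bellmanErr f h z.1 - M.bellmanErr g h z.1| * |a| +
        |M.bellmanErr g h z.1| * |a - b| := by
        rw [← abs_mul, ← abs_mul]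
        exact abs_add_le _ _
    -- The Bellman errors differ by `2 ρ`, the other factors by `4 ρ`.
    _ ≤ 2 * ρ * (4 * M.H) + M.H * (4 * ρ) := by gcongr
    _ = 12 * M.H * ρ := by ring

theorem meanSqErr_sub_le (G : M.GreedyRule F) (hB : M.IsBoundedClass F)
    (hC : M.BellmanComplete F) {f g : QFun S A}
    (hf : f ∈ M.fnClass F) (hg : g ∈ M.fnClass F) {ρ : ℝ} (hfg : ∀ h x, |f h x - g h x| ≤ ρ)
    {h : ℕ} (hh : h < M.H) (π : Policy S A) :
    M.meanSqErr π f h - M.meanSqErr π g h ≤ 4 * M.H * ρ := by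
  have hif := integrable_sq_bellmanErr hB hC hf hh (M.occ π h)
  have hig := integrable_sq_bellmanErr hB hC hg hh (M.occ π h)
  rw [meanSqErr, meanSqErr, ← integral_sub hif hig]
  have hle : ∀ x, M.bellmanErr f h x ^ 2 - M.bellmanErr g h x ^ 2 ≤ 4 * M.H * ρ := fun x => by
    have h1 := abs_bellmanErr_sub_le G hB hf hg hfg h x
    have h2 := abs_bellmanErr_le hB hC hf hh x
    have h3 := abs_bellmanErr_le hB hC hg hh x
    have hH : (0 : ℝ) ≤ M.H := Nat.cast_nonneg _
    calc M.bellmanErr f h x ^ 2 - M.bellmanErr g h x ^ 2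
        = (M.bellmanErr f h x - M.bellmanErr g h x) * (M.bellmanErr f h x + M.bellmanErr g h x) := by
          ring
      _ ≤ |M.bellmanErr f h x - M.bellmanErr g h x| *
          |M.bellmanErr f h x + M.bellmanErr g h x| := by
          rw [← abs_mul]
          exact le_abs_self _
      _ ≤ 2 * ρ * (M.H + M.H) := by
          have := (abs_nonneg _).trans h1
          gcongr
          exact (abs_add_le _ _).trans (add_le_add h2 h3)
      _ = 4 * M.H * ρ := by ring
  have := integral_mono (hif.sub hig) (integrable_const (4 * M.H * ρ)) hle
  simpa using this

/-- The cumulative expected squared Bellman error of `f` over the policies that generated `D`. -/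
def cumSqErr (G : M.GreedyRule F) (πoff : Policy S A) (sel : (t : ℕ) → M.History Noff t → QFun S A)
    (f : QFun S A) (h : ℕ) {t : ℕ} (D : M.History Noff t) : ℝ :=
  (∑ _i : Fin Noff, M.meanSqErr πoff f h) +
    ∑ i : Fin t, M.meanSqErr (G.policy (sel i (History.upTo D i))) f h

/-- The cumulative excess loss of `f` on the data `D`. -/
def cumExcess (f : QFun S A) (h : Fin M.H) {t : ℕ} (D : M.History Noff t) : ℝ :=
  (∑ i : Fin Noff, M.excess f h (D.1 i h)) + ∑ i : Fin t, M.excess f h (D.2 i h)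

theorem cumExcess_eq_loss_sub (f : QFun S A) (h : Fin M.H) {t : ℕ} (D : M.History Noff t) :
    cumExcess f h D = M.loss D h (f h) (f (h + 1)) -
      M.loss D h (M.bellman h (f (h + 1))) (f (h + 1)) := by
  simp only [cumExcess, loss, excess, Finset.sum_sub_distrib]
  ring

theorem runWeight_eq (πoff : Policy S A) (f : QFun S A) (h : Fin M.H) {t : ℕ}
    (D : M.History Noff t) : runWeight G πoff sel f h D = ENNReal.ofReal (Real.exp
      ((32 * (M.H : ℝ) ^ 2)⁻¹ * (cumSqErr G πoff sel f h D / 2 - cumExcess f h D))) := by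
  simp only [runWeight, expWeight]
  rw [← ENNReal.ofReal_prod_of_nonneg (fun _ _ => (Real.exp_pos _).le),
    ← ENNReal.ofReal_prod_of_nonneg (fun _ _ => (Real.exp_pos _).le),
    ← ENNReal.ofReal_mul (Finset.prod_nonneg fun _ _ => (Real.exp_pos _).le),
    ← Real.exp_sum, ← Real.exp_sum, ← Real.exp_add, ← Finset.mul_sum, ← Finset.mul_sum, ← mul_add]
  simp only [Finset.sum_sub_distrib, ← Finset.sum_div, cumSqErr, cumExcess]
  congr 3
  ring

/-- Per episode, half of the `4 H ρ` from the squared errors plus the `12 H ρ` from the excess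
losses. -/
theorem cumSqErr_sub_cumExcess_le (hB : M.IsBoundedClass F) (hC : M.BellmanComplete F)
    (πoff : Policy S A) {f g : QFun S A}
    (hf : f ∈ M.fnClass F) (hg : g ∈ M.fnClass F) {ρ : ℝ} (hfg : ∀ h x, |f h x - g h x| ≤ ρ)
    (h : Fin M.H) {t : ℕ} (D : M.History Noff t) :
    cumSqErr G πoff sel f h D / 2 - cumExcess f h D ≤
      cumSqErr G πoff sel g h D / 2 - cumExcess g h D + (Noff + t : ℝ) * (14 * M.H * ρ) := by
  have h1 := fun π => meanSqErr_sub_le G hB hC hf hg hfg h.isLt π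
  have h2 := fun z => (abs_le.1 (abs_excess_sub_le G hB hC hf hg hfg h.isLt z)).1
  have h3 : cumSqErr G πoff sel f h D - cumSqErr G πoff sel g h D ≤
      (Noff + t : ℝ) * (4 * M.H * ρ) := by
    have e1 : ∑ _i : Fin Noff, (M.meanSqErr πoff f h - M.meanSqErr πoff g h) ≤
        ∑ _i : Fin Noff, 4 * M.H * ρ := Finset.sum_le_sum fun i _ => h1 _
    have e2 : ∑ i : Fin t, (M.meanSqErr (G.policy (sel i (History.upTo D i))) f h -
        M.meanSqErr (G.policy (sel i (History.upTo D i))) g h) ≤ ∑ _i : Fin t, 4 * M.H * ρ :=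
      Finset.sum_le_sum fun i _ => h1 _
    simp only [Finset.sum_sub_distrib, Finset.sum_const, Finset.card_univ, Fintype.card_fin,
      nsmul_eq_mul] at e1 e2
    simp only [cumSqErr, Finset.sum_const, Finset.card_univ, Fintype.card_fin, nsmul_eq_mul]
    linarith
  have h4 : -((Noff + t : ℝ) * (12 * M.H * ρ)) ≤ cumExcess f h D - cumExcess g h D := by
    have e1 : ∑ _i : Fin Noff, -(12 * M.H * ρ) ≤
        ∑ i : Fin Noff, (M.excess f h (D.1 i h) - M.excess g h (D.1 i h)) :=
      Finset.sum_le_sum fun i _ => h2 _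
    have e2 : ∑ _i : Fin t, -(12 * M.H * ρ) ≤
        ∑ i : Fin t, (M.excess f h (D.2 i h) - M.excess g h (D.2 i h)) :=
      Finset.sum_le_sum fun i _ => h2 _
    simp only [Finset.sum_sub_distrib, Finset.sum_const, Finset.card_univ, Fintype.card_fin,
      nsmul_eq_mul] at e1 e2
    simp only [cumExcess]
    linarith
  linarith

/-- The concentration event: in all rounds, at all steps and for all `f`, the cumulative excess
loss controls the cumulative squared Bellman error. -/
def Concentrated (G : M.GreedyRule F) (πoff : Policy S A)
    (sel : (t : ℕ) → M.History Noff t → QFun S A) (w : ℝ) (D : M.History Noff Non) : Prop :=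
  ∀ t : Fin Non, ∀ h : Fin M.H, ∀ f ∈ M.fnClass F,
    cumSqErr G πoff sel f h (History.upTo D t) / 2 - cumExcess f h (History.upTo D t) ≤ w

/-- Completeness puts `optQ` in the class, so a cover cannot be empty. -/
theorem one_le_toNat_coverNum (hC : M.BellmanComplete F) {ρ : ℝ≥0} (hρ : M.coverNum F ρ ≠ ⊤) :
    1 ≤ (M.coverNum F ρ).toNat := by
  obtain ⟨C, -, hcard, hcov⟩ := exists_finset_cover hρ
  obtain ⟨g, hg, -⟩ := hcov _ (optQ_mem_fnClass hC)
  exact (Finset.card_pos.2 ⟨g, hg⟩).trans_le hcard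

theorem log_two_le_log (hC : M.BellmanComplete F) {N : ℕ} (hN : 2 ≤ N) (hH : 1 ≤ M.H) {δ : ℝ}
    (hδ : 0 < δ) (hδ1 : δ < 1) {ρ : ℝ≥0} (hρ : M.coverNum F ρ ≠ ⊤) :
    Real.log 2 ≤ Real.log ((N : ℝ) * M.H * ((M.coverNum F ρ).toNat : ℝ) / δ) := by
  have h1 : (1 : ℝ) ≤ (M.coverNum F ρ).toNat := by exact_mod_cast one_le_toNat_coverNum hC hρ
  have h2 : (2 : ℝ) ≤ N := by exact_mod_cast hN
  have h3 : (1 : ℝ) ≤ M.H := by exact_mod_cast hH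
  refine Real.log_le_log two_pos ?_
  rw [le_div_iff₀ hδ]
  calc 2 * δ ≤ 2 * 1 * 1 := by linarith
    _ ≤ _ := by gcongr

theorem runLaw_not_concentrated_le (hsel : M.IsDiscGolf G w warm Noff Non sel)
    (hB : M.IsBoundedClass F) (hC : M.BellmanComplete F) (πoff : Policy S A) (hH : 1 ≤ M.H)
    (hoff : 1 ≤ Noff) (hon : 1 ≤ Non) {δ : ℝ} (hδ : 0 < δ) (hδ1 : δ < 1)
    (hcov : M.coverNum F (1 / ((Noff + Non : ℕ) : ℝ≥0)) ≠ ⊤) :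
    M.runLaw G πoff sel Non {D | ¬ Concentrated G πoff sel
      ((M.H : ℝ) ^ 2 * M.betaParam F 64 (Noff + Non) δ) D} ≤ ENNReal.ofReal δ := by
  obtain ⟨C, hCF, hcard, hC'⟩ := exists_finset_cover hcov
  set n := (M.coverNum F (1 / ((Noff + Non : ℕ) : ℝ≥0))).toNat with hn
  have hn1 : (1 : ℝ) ≤ n := by exact_mod_cast one_le_toNat_coverNum hC hcov
  have hH1 : (1 : ℝ) ≤ M.H := by exact_mod_cast hH
  have hN2 : 2 ≤ Noff + Non := by omega
  have hN : (2 : ℝ) ≤ (Noff + Non : ℕ) := by exact_mod_cast hN2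
  have hL := log_two_le_log hC hN2 hH hδ hδ1 hcov
  have hLdef : M.betaParam F 64 (Noff + Non) δ =
    64 * Real.log (((Noff + Non : ℕ) : ℝ) * M.H * n / δ) := rfl
  rw [← hn] at hL
  rw [hLdef]
  -- Threshold for Markov's inequality: the union bound has at most `Non * H * n ≤ q δ` terms, each
  -- of probability at most `1 / q`.
  set q : ℝ := ((Noff + Non : ℕ) : ℝ) * M.H * n / δ with hq
  have hqpos : 0 < q := by positivity
  have hbad := runLaw_exists_weight_gt_le hsel hB hC πoff C hCF (a := ENNReal.ofReal q)
    (by simpa using hqpos) ENNReal.ofReal_ne_top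
  refine le_trans (measure_mono ?_) (hbad.trans ?_)
  -- Concentration ranges over a possibly uncountable class, so its failure is bounded by inclusion
  -- in the bad event of the finite cover.
  · intro D
    simp only [Set.mem_ofPred_eq]
    contrapose!
    intro hD t h f hf
    obtain ⟨g, hg, hfg⟩ := hC' f hf
    have h1 := hD t h g hg
    rw [runWeight_eq, ENNReal.ofReal_lt_ofReal_iff hqpos, ← Real.lt_log_iff_exp_lt hqpos,
      inv_mul_lt_iff₀ (by positivity)] at h1
    refine (cumSqErr_sub_cumExcess_le hB hC πoff hf (hCF g hg) hfg h _).trans ?_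
    have hlog2 := Real.log_two_gt_d9
    have hρ : (Noff + (t : ℕ) : ℝ) * (14 * M.H * ((1 / ((Noff + Non : ℕ) : ℝ≥0) : ℝ≥0) : ℝ)) ≤
        14 * M.H := by
      have ht : ((Noff : ℝ) + (t : ℕ)) ≤ (Noff + Non : ℕ) := by
        exact_mod_cast Nat.add_le_add_left t.isLt.le Noff
      push_cast at ht hN ⊢
      rw [mul_one_div, ← mul_div_assoc, div_le_iff₀ (by linarith), mul_comm]
      gcongr
    have h2 : 14 * (M.H : ℝ) ≤ 14 * (M.H : ℝ) ^ 2 := by nlinarith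
    -- With radius `1 / N` the discretization costs at most `14 H`. As `14 ≤ 32 log 2 ≤ 32 log q`,
    -- it fits into a second copy of the deviation `32 H² log q`, whence the constant 64.
    have h3 : 14 * (M.H : ℝ) ^ 2 ≤ 32 * (M.H : ℝ) ^ 2 * Real.log q := by
      have : 14 ≤ 32 * Real.log q := by linarith
      nlinarith [sq_nonneg (M.H : ℝ)]
    linarith
  · rw [show ((Non : ℝ≥0∞) * M.H * C.card) = ENNReal.ofReal ((Non : ℝ) * M.H * C.card) by
      rw [ENNReal.ofReal_mul (by positivity), ENNReal.ofReal_mul (by positivity)]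
      simp only [ENNReal.ofReal_natCast], ← ENNReal.ofReal_div_of_pos hqpos]
    refine ENNReal.ofReal_le_ofReal ?_
    rw [div_le_iff₀ hqpos, hq, mul_div_cancel₀ _ hδ.ne']
    have hc : (C.card : ℝ) ≤ n := by exact_mod_cast hcard
    have hNon : (Non : ℝ) ≤ (Noff + Non : ℕ) := by exact_mod_cast Nat.le_add_left Non Noff
    gcongr

/-- On the concentration event the optimal Q-function is never excluded. -/
theorem optQ_mem_candidates (hC : M.BellmanComplete F)
    {πoff : Policy S A} {D : M.History Noff Non} (hD : Concentrated G πoff sel w D) (t : Fin Non) :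
    M.optQ ∈ M.candidates F w warm (History.upTo D t) := by
  have hopt := optQ_mem_fnClass hC (M := M)
  unfold candidates
  split_ifs
  · exact hopt
  refine ⟨hopt, fun h g hg => ?_⟩
  -- The competitor `g` is tested by placing it at step `h` of `optQ`: the Bellman backup at that
  -- step is then `optQ h`, so the excess of `f` is the loss of `g` minus that of `optQ h`.
  -- Concentration and nonnegativity of the squared error bound it below by `-w`.
  set f := Function.update M.optQ h g
  have hfm : f ∈ M.fnClass F := update_mem_fnClass hopt h.isLt hg
  have h1 := hD t h f hfm
  have h2 : f h = g := Function.update_self ..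
  have h3 : f (h + 1) = M.optQ (h + 1) := Function.update_of_ne (by omega) ..
  rw [cumExcess_eq_loss_sub, h2, h3, ← optQ_of_lt h.isLt] at h1
  have h4 : 0 ≤ cumSqErr G πoff sel f h (History.upTo D t) :=
    add_nonneg (Finset.sum_nonneg fun _ _ => meanSqErr_nonneg _ _ _)
      (Finset.sum_nonneg fun _ _ => meanSqErr_nonneg _ _ _)
  linarith

/-- On the concentration event all members of the confidence sets have small Bellman errors. -/
theorem cumSqErr_le_of_mem_confSet (hC : M.BellmanComplete F) {πoff : Policy S A}
    {D : M.History Noff Non} (hD : Concentrated G πoff sel w D) (t : Fin Non)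
    {f : QFun S A} (hf : f ∈ M.confSet F w (History.upTo D t)) (h : Fin M.H) :
    cumSqErr G πoff sel f h (History.upTo D t) ≤ 4 * w := by
  have h1 := hD t h f hf.1
  -- With the Bellman backup as competitor the excess is at most `w`; concentration then bounds half
  -- the squared error by `2 w`.
  have h2 := hf.2 h _ (bellman_mem hC hf.1 h.isLt)
  rw [cumExcess_eq_loss_sub] at h1
  linarith

theorem candidates_subset_fnClass {t : ℕ} (D : M.History Noff t) :
    M.candidates F w warm D ⊆ M.fnClass F := by
  unfold candidates
  split_ifs
  · exact subset_rfl
  · exact fun f hf => hf.1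

/-- On the concentration event the regret of a round is at most the sum of the Bellman errors. -/
theorem optValue_sub_value_le (hsel : M.IsDiscGolf G w warm Noff Non sel)
    (hB : M.IsBoundedClass F) (hC : M.BellmanComplete F)
    {πoff : Policy S A} {D : M.History Noff Non} (hD : Concentrated G πoff sel w D) (t : Fin Non) :
    M.optValue - M.value (G.policy (sel t (History.upTo D t))) ≤
      ∑ h : Fin M.H, ∫ x, M.bellmanErr (sel t (History.upTo D t)) h x
        ∂(M.occ (G.policy (sel t (History.upTo D t))) h) := by
  have hmem := candidates_subset_fnClass _ (hsel.mem t t.isLt (History.upTo D t))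
  have h1 := hsel.argmax t t.isLt (History.upTo D t) _ (optQ_mem_candidates hC hD t)
  rw [← maxVal_eq G hB (optQ_mem_fnClass hC), ← maxVal_eq G hB hmem] at h1
  have h2 := optValue_le G hB hC
  rw [value_greedy G hB hC hmem, Fin.sum_univ_eq_sum_range (fun h =>
    ∫ x, M.bellmanErr (sel t (History.upTo D t)) h x
        ∂(M.occ (G.policy (sel t (History.upTo D t))) h))]
  linarith

end

/-! ### From small Bellman errors to the regret bound. -/

section

theorem sq_mul_rpow_half (x y : ℝ≥0∞) :
    (x ^ 2 * y) ^ (1 / 2 : ℝ) = x * y ^ (1 / 2 : ℝ) := by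
  rw [ENNReal.mul_rpow_of_nonneg _ _ (by norm_num), ← ENNReal.rpow_natCast, ← ENNReal.rpow_mul]
  norm_num

theorem le_rpow_half_of_sq_le {x y : ℝ≥0∞} (h : x ^ 2 ≤ y) : x ≤ y ^ (1 / 2 : ℝ) := by
  have h1 := ENNReal.rpow_le_rpow h (z := (1 / 2 : ℝ)) (by norm_num)
  simpa using (sq_mul_rpow_half x 1).ge.trans (by simpa using h1)

theorem enorm_sq_eq_ofReal (x : ℝ) : ‖x‖ₑ ^ 2 = ENNReal.ofReal (x ^ 2) := by
  rw [Real.enorm_eq_ofReal_abs, ← ENNReal.ofReal_pow (abs_nonneg x), sq_abs]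

theorem setLIntegral_enorm_le {Ω : Type*} [MeasurableSpace Ω] (μ : Measure Ω)
    [IsProbabilityMeasure μ] {g : Ω → ℝ} (hg : Measurable g) (X : Set Ω) :
    ∫⁻ x in X, ‖g x‖ₑ ∂μ ≤ (∫⁻ x in X, ENNReal.ofReal (g x ^ 2) ∂μ) ^ (1 / 2 : ℝ) := by
  have h1 := ENNReal.lintegral_mul_le_Lp_mul_Lq (μ.restrict X) Real.HolderConjugate.two_two
    (f := fun x => ‖g x‖ₑ) (g := fun _ => 1) hg.enorm.aemeasurable aemeasurable_const
  have h2 : (μ.restrict X Set.univ) ^ (1 / 2 : ℝ) ≤ 1 := by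
    have h3 : μ.restrict X Set.univ ≤ 1 := by
      rw [Measure.restrict_apply_univ]
      exact prob_le_one
    simpa using ENNReal.rpow_le_rpow h3 (z := (1 / 2 : ℝ)) (by norm_num)
  simp only [Pi.mul_apply, mul_one, ENNReal.one_rpow, lintegral_one] at h1
  refine h1.trans ((mul_le_of_le_one_right' h2).trans (le_of_eq ?_))
  congr 1
  refine lintegral_congr fun x => ?_
  rw [← enorm_sq_eq_ofReal, ← ENNReal.rpow_natCast]
  norm_num

/-- The sets may overlap, and the integral over `Y` must be kept whole: it is signed, so shrinking
`Y` to `Y \ X` could enlarge it. The overlap is subtracted instead and, lying in `X`, is bounded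
like the integral over `X`; hence the factor 2. -/
theorem enorm_integral_le_of_cover {Ω : Type*} [MeasurableSpace Ω] (μ : Measure Ω)
    [IsProbabilityMeasure μ] {g : Ω → ℝ} (hg : Measurable g) (hgi : Integrable g μ) {X Y : Set Ω}
    (hX : MeasurableSet X) (hXY : X ∪ Y = Set.univ) :
    ‖∫ x, g x ∂μ‖ₑ ≤
      2 * (∫⁻ x in X, ENNReal.ofReal (g x ^ 2) ∂μ) ^ (1 / 2 : ℝ) + ‖∫ x in Y, g x ∂μ‖ₑ := by
  have h1 : ∫ x, g x ∂μ = ∫ x in X, g x ∂μ - ∫ x in Y ∩ X, g x ∂μ + ∫ x in Y, g x ∂μ := by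
    have h2 : Xᶜ = Y \ X := by
      rw [Set.compl_eq_univ_sdiff, ← hXY, Set.union_sdiff_left]
    rw [← integral_add_compl hX hgi,
      ← integral_inter_add_sdiff (s := Y) hX hgi.integrableOn, h2]
    ring
  have hb : ∀ Z ⊆ X, ‖∫ x in Z, g x ∂μ‖ₑ ≤
      (∫⁻ x in X, ENNReal.ofReal (g x ^ 2) ∂μ) ^ (1 / 2 : ℝ) := fun Z hZ =>
    (enorm_integral_le_lintegral_enorm _).trans
      ((lintegral_mono_set hZ).trans (setLIntegral_enorm_le μ hg X))
  rw [h1, two_mul]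
  refine (enorm_add_le _ _).trans (add_le_add_left ((enorm_sub_le).trans ?_) _)
  exact add_le_add (hb X subset_rfl) (hb _ Set.inter_subset_right)

/-- Cauchy–Schwarz, `(∑ a)² ≤ card * ∑ a²`, followed by `a² = d * (a² / d) ≤ K * (a² / d)`. -/
theorem sum_le_rpow_half_of_sum_div_le {ι : Type*} (s : Finset ι) (a d : ι → ℝ≥0∞) {K c : ℝ≥0∞}
    (hd : ∀ i ∈ s, d i ≠ 0) (hK : K ≠ ∞) (hdK : ∀ i ∈ s, d i ≤ K)
    (hc : ∑ i ∈ s, a i ^ 2 / d i ≤ c) :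
    ∑ i ∈ s, a i ≤ (s.card * (K * c)) ^ (1 / 2 : ℝ) := by
  refine le_rpow_half_of_sq_le ?_
  have h1 := ENNReal.rpow_sum_le_const_mul_sum_rpow s a (p := 2) (by norm_num)
  norm_num at h1
  refine h1.trans (mul_le_mul_right ?_ _)
  refine le_trans ?_ (mul_le_mul_right hc _)
  rw [Finset.mul_sum]
  refine Finset.sum_le_sum fun i hi => ?_
  have hdi : d i ≠ ∞ := ne_top_of_le_ne_top hK (hdK i hi)
  calc a i ^ 2 = d i * (a i ^ 2 / d i) := (ENNReal.mul_div_cancel (hd i hi) hdi).symm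
    _ ≤ K * (a i ^ 2 / d i) := mul_le_mul_left (hdK i hi) _

theorem sum_filter_lt_eq {β : Type*} [AddCommMonoid β] {T : ℕ} (t : Fin T) (φ : Fin T → β) :
    ∑ i : Fin T with i < t, φ i = ∑ i : Fin t, φ (Fin.castLE t.isLt.le i) := by
  have h1 : (Finset.univ.filter fun i : Fin T => i < t) =
      Finset.univ.map (Fin.castLEEmb t.isLt.le) := by
    ext i
    simp only [Finset.mem_filter, Finset.mem_univ, true_and, Finset.mem_map]
    constructor
    · exact fun hi => ⟨⟨i, hi⟩, rfl⟩
    · rintro ⟨j, rfl⟩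
      exact j.isLt
  rw [h1, Finset.sum_map]
  rfl

variable {M : MDP S A} {F : ℕ → Set (S × A → ℝ)} {G : M.GreedyRule F} {w : ℝ} {warm : Bool}
  {Noff Non : ℕ} {sel : (t : ℕ) → M.History Noff t → QFun S A}

theorem sqErr_le_ofReal_meanSqErr (hB : M.IsBoundedClass F) (hC : M.BellmanComplete F)
    {f : QFun S A} (hf : f ∈ M.fnClass F) {h : ℕ} (hh : h < M.H) (π : Policy S A)
    (X : ℕ → Set (S × A)) : M.sqErr (M.occ π h) X f h ≤ ENNReal.ofReal (M.meanSqErr π f h) := by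
  rw [meanSqErr, ofReal_integral_eq_lintegral_ofReal (integrable_sq_bellmanErr hB hC hf hh _)
    (ae_of_all _ fun _ => sq_nonneg _)]
  exact setLIntegral_le_lintegral _ _

theorem sqErr_le_cOff_mul (hB : M.IsBoundedClass F) (hC : M.BellmanComplete F)
    {πoff : Policy S A} {X : ℕ → Set (S × A)} (hX : M.cOff G πoff X ≠ ∞) {f g : QFun S A}
    (hf : f ∈ M.fnClass F) (hg : g ∈ M.fnClass F) (h : Fin M.H) :
    M.sqErr (M.occ (G.policy g) h) X f h ≤ M.cOff G πoff X * M.sqErr (M.occ πoff h) X f h := by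
  have h1 : M.sqErr (M.occ (G.policy g) h) X f h / M.sqErr (M.occ πoff h) X f h ≤
      M.cOff G πoff X :=
    le_iSup_of_le h (le_iSup_of_le ⟨f, hf⟩ (le_iSup_of_le ⟨g, hg⟩ le_rfl))
  have h2 : M.sqErr (M.occ πoff h) X f h ≠ ∞ :=
    ne_top_of_le_ne_top ENNReal.ofReal_ne_top (sqErr_le_ofReal_meanSqErr hB hC hf h.isLt πoff X)
  exact (ENNReal.div_le_iff_le_mul (Or.inr hX) (Or.inl h2)).1 h1

/-- On the concentration event, the Bellman errors on the part covered by the offline data. -/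
theorem sqErr_le_of_mem_confSet (hB : M.IsBoundedClass F) (hC : M.BellmanComplete F)
    (hoff : 1 ≤ Noff) {πoff : Policy S A} {D : M.History Noff Non}
    (hD : Concentrated G πoff sel w D) (t : Fin Non) {f g : QFun S A}
    (hf : f ∈ M.confSet F w (History.upTo D t)) (hg : g ∈ M.fnClass F) {X : ℕ → Set (S × A)}
    (hX : M.cOff G πoff X ≠ ∞) (h : Fin M.H) :
    M.sqErr (M.occ (G.policy g) h) X f h ≤
      M.cOff G πoff X * (ENNReal.ofReal (4 * w) / Noff) := by
  refine (sqErr_le_cOff_mul hB hC hX hf.1 hg h).trans (mul_le_mul_right ?_ _)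
  refine (sqErr_le_ofReal_meanSqErr hB hC hf.1 h.isLt πoff X).trans ?_
  have hN : (0 : ℝ) < Noff := by exact_mod_cast hoff
  rw [← ENNReal.ofReal_natCast Noff, ← ENNReal.ofReal_div_of_pos hN]
  refine ENNReal.ofReal_le_ofReal ?_
  rw [le_div_iff₀ hN, mul_comm]
  refine le_trans ?_ (cumSqErr_le_of_mem_confSet hC hD t hf h)
  rw [cumSqErr, Finset.sum_const, Finset.card_univ, Fintype.card_fin, nsmul_eq_mul]
  exact le_add_of_nonneg_right (Finset.sum_nonneg fun _ _ => meanSqErr_nonneg _ _ _)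

theorem sum_sqErr_le_of_mem_confSet (hB : M.IsBoundedClass F) (hC : M.BellmanComplete F)
    {πoff : Policy S A} {D : M.History Noff Non} (hD : Concentrated G πoff sel w D) (t : Fin Non)
    {f : QFun S A} (hf : f ∈ M.confSet F w (History.upTo D t)) (X : ℕ → Set (S × A))
    (h : Fin M.H) :
    ∑ i : Fin Non with i < t,
      M.sqErr (M.occ (G.policy (sel i (History.upTo D i))) h) X f h ≤ ENNReal.ofReal (4 * w) := by
  rw [sum_filter_lt_eq]
  refine le_trans (Finset.sum_le_sum fun i _ =>
    sqErr_le_ofReal_meanSqErr hB hC hf.1 h.isLt _ X) ?_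
  rw [← ENNReal.ofReal_sum_of_nonneg fun _ _ => meanSqErr_nonneg _ _ _]
  refine ENNReal.ofReal_le_ofReal (le_trans ?_ (cumSqErr_le_of_mem_confSet hC hD t hf h))
  exact le_add_of_nonneg_left (Finset.sum_nonneg fun _ _ => meanSqErr_nonneg _ _ _)

theorem mem_confSet_of_mem_candidates {t : ℕ} {D : M.History Noff t} {f : QFun S A}
    (hf : f ∈ M.candidates F w warm D) (ht : ¬ (t = 0 ∧ warm = false)) : f ∈ M.confSet F w D := by
  rwa [candidates, if_neg ht] at hf

theorem sum_enorm_online_le (hsel : M.IsDiscGolf G w warm Noff Non sel)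
    (hB : M.IsBoundedClass F) (hC : M.BellmanComplete F) (hH : 1 ≤ M.H)
    (hw : (M.H : ℝ) ^ 2 ≤ 4 * w)
    {πoff : Policy S A} {D : M.History Noff Non} (hD : Concentrated G πoff sel w D)
    (X : ℕ → Set (S × A)) (h : Fin M.H) :
    ∑ t : Fin Non, ‖∫ x in X h, M.bellmanErr (sel t (History.upTo D t)) h x
        ∂(M.occ (G.policy (sel t (History.upTo D t))) h)‖ₑ ≤
      (Non * (ENNReal.ofReal (4 * w) * M.cOn G X Non)) ^ (1 / 2 : ℝ) := by
  have hmem : ∀ t : Fin Non, sel t (History.upTo D t) ∈ M.fnClass F := fun t =>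
    candidates_subset_fnClass _ (hsel.mem t t.isLt _)
  have hHw : (M.H : ℝ≥0∞) ^ 2 ≤ ENNReal.ofReal (4 * w) := by
    rw [← ENNReal.ofReal_natCast, ← ENNReal.ofReal_pow (Nat.cast_nonneg _)]
    exact ENNReal.ofReal_le_ofReal hw
  have h1 := sum_le_rpow_half_of_sum_div_le (Finset.univ : Finset (Fin Non))
    (fun t => ‖∫ x in X h, M.bellmanErr (sel t (History.upTo D t)) h x
        ∂(M.occ (G.policy (sel t (History.upTo D t))) h)‖ₑ)
    (fun t => max ((M.H : ℝ≥0∞) ^ 2) (∑ i : Fin Non with i < t,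
      M.sqErr (M.occ (G.policy (sel i (History.upTo D i))) h) X (sel t (History.upTo D t)) h))
    (K := ENNReal.ofReal (4 * w)) (c := M.cOn G X Non) ?_ ENNReal.ofReal_ne_top ?_ ?_
  · simpa using h1
  · intro t _
    refine (lt_of_lt_of_le ?_ (le_max_left _ _)).ne'
    have : (M.H : ℝ≥0∞) ≠ 0 := by exact_mod_cast (by omega : M.H ≠ 0)
    positivity
  · intro t _
    refine max_le hHw ?_
    -- In a cold first round the function lies in no confidence set, but the sum over earlier rounds
    -- is empty.
    by_cases ht : (t : ℕ) = 0 ∧ warm = false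
    · rw [Finset.filter_false_of_mem, Finset.sum_empty]
      · exact zero_le
      · intro i _ hi
        have : (i : ℕ) < t := hi
        omega
    · exact sum_sqErr_le_of_mem_confSet hB hC hD t
        (mem_confSet_of_mem_candidates (hsel.mem t t.isLt _) ht) X h
  · simp only [enorm_sq_eq_ofReal]
    -- The chosen functions and their own greedy policies form one admissible pair of sequences in
    -- the supremum defining `cOn`.
    exact le_iSup_of_le h (le_iSup_of_le (fun t => ⟨_, hmem t⟩)
      (le_iSup_of_le (fun t => ⟨_, hmem t⟩) le_rfl))

theorem optValue_sub_value_le_horizon (G : M.GreedyRule F) (hB : M.IsBoundedClass F)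
    (hC : M.BellmanComplete F) (π : Policy S A) : M.optValue - M.value π ≤ M.H := by
  linarith [optValue_le G hB hC, (maxVal_mem_Icc G hB (optQ_mem_fnClass hC) 0 M.x₁).2,
    M.value_nonneg π]

theorem ofReal_optValue_sub_value_le (hsel : M.IsDiscGolf G w warm Noff Non sel)
    (hB : M.IsBoundedClass F) (hC : M.BellmanComplete F) (hoff : 1 ≤ Noff)
    {πoff : Policy S A} {D : M.History Noff Non} (hD : Concentrated G πoff sel w D)
    {Xoff Xon : ℕ → Set (S × A)} (hX : M.IsPartition Xoff Xon) (hcoff : M.cOff G πoff Xoff ≠ ∞)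
    (t : Fin Non) :
    ENNReal.ofReal (M.optValue - M.value (G.policy (sel t (History.upTo D t)))) ≤
      (if (t : ℕ) = 0 ∧ warm = false then (M.H : ℝ≥0∞) else 0) +
      ∑ h : Fin M.H,
        (2 * (M.cOff G πoff Xoff * (ENNReal.ofReal (4 * w) / Noff)) ^ (1 / 2 : ℝ) +
        ‖∫ x in Xon h, M.bellmanErr (sel t (History.upTo D t)) h x
          ∂(M.occ (G.policy (sel t (History.upTo D t))) h)‖ₑ) := by
  split_ifs with ht
  -- A cold first round is charged the trivial bound `H`.
  · refine le_add_right ?_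
    rw [← ENNReal.ofReal_natCast]
    exact ENNReal.ofReal_le_ofReal (optValue_sub_value_le_horizon G hB hC _)
  · rw [zero_add]
    have hconf := mem_confSet_of_mem_candidates (hsel.mem t t.isLt (History.upTo D t)) ht
    refine (ENNReal.ofReal_le_ofReal (optValue_sub_value_le hsel hB hC hD t)).trans ?_
    refine (Finset.le_sum_of_subadditive ENNReal.ofReal ENNReal.ofReal_zero.le
      (fun _ _ => ENNReal.ofReal_add_le) _ _).trans (Finset.sum_le_sum fun h _ => ?_)
    have hm := measurable_bellmanErr hB hC hconf.1 h.isLt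
    have hi : Integrable (M.bellmanErr (sel t (History.upTo D t)) h)
        (M.occ (G.policy (sel t (History.upTo D t))) h) :=
      integrable_of_Icc hm fun x => abs_le.1 (abs_bellmanErr_le hB hC hconf.1 h.isLt x)
    refine (Real.ofReal_le_enorm _).trans
      ((enorm_integral_le_of_cover _ hm hi (hX.1 h) (hX.2.2 h h.isLt)).trans ?_)
    gcongr
    exact sqErr_le_of_mem_confSet hB hC hoff hD t hconf hconf.1 hcoff h

theorem ofReal_regret_le (hsel : M.IsDiscGolf G w warm Noff Non sel)
    (hB : M.IsBoundedClass F) (hC : M.BellmanComplete F) (hH : 1 ≤ M.H) (hoff : 1 ≤ Noff)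
    (hw : (M.H : ℝ) ^ 2 ≤ 4 * w)
    {πoff : Policy S A} {D : M.History Noff Non} (hD : Concentrated G πoff sel w D)
    {Xoff Xon : ℕ → Set (S × A)} (hX : M.IsPartition Xoff Xon)
    (hcoff : M.cOff G πoff Xoff ≠ ∞) :
    ENNReal.ofReal (M.regret G sel D) ≤ (if warm then 0 else (M.H : ℝ≥0∞)) +
      (Non * M.H * (2 * (M.cOff G πoff Xoff * (ENNReal.ofReal (4 * w) / Noff)) ^ (1 / 2 : ℝ)) +
      M.H * (Non * (ENNReal.ofReal (4 * w) * M.cOn G Xon Non)) ^ (1 / 2 : ℝ)) := by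
  refine (Finset.le_sum_of_subadditive ENNReal.ofReal ENNReal.ofReal_zero.le
    (fun _ _ => ENNReal.ofReal_add_le) _ _).trans ?_
  refine (Finset.sum_le_sum fun t _ =>
    ofReal_optValue_sub_value_le hsel hB hC hoff hD hX hcoff t).trans ?_
  rw [Finset.sum_add_distrib]
  refine add_le_add ?_ ?_
  · cases warm with
    | true => simp
    | false =>
      simp only [and_true, Bool.false_eq_true, if_false]
      rcases Non with _ | n
      · simp
      · rw [Fin.sum_univ_succ]
        simp
  · rw [Finset.sum_comm]
    simp only [Finset.sum_add_distrib, Finset.sum_const, Finset.card_univ, Fintype.card_fin,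
      nsmul_eq_mul]
    refine add_le_add (le_of_eq (by ring)) ?_
    refine (Finset.sum_le_sum fun h _ => sum_enorm_online_le hsel hB hC hH hw hD Xon h).trans ?_
    simp

theorem ofReal_regret_le_regretBound {β : ℝ}
    (hsel : M.IsDiscGolf G ((M.H : ℝ) ^ 2 * β) warm Noff Non sel)
    (hB : M.IsBoundedClass F) (hC : M.BellmanComplete F) (hH : 1 ≤ M.H) (hoff : 1 ≤ Noff)
    (hon : 1 ≤ Non) (hβ : 1 ≤ β) {πoff : Policy S A} {D : M.History Noff Non}
    (hD : Concentrated G πoff sel ((M.H : ℝ) ^ 2 * β) D) :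
    ENNReal.ofReal (M.regret G sel D) ≤ (if warm then 0 else (M.H : ℝ≥0∞)) +
      ENNReal.ofReal 4 * M.regretBound G πoff Noff Non β := by
  have hw : (M.H : ℝ) ^ 2 ≤ 4 * ((M.H : ℝ) ^ 2 * β) := by nlinarith [sq_nonneg (M.H : ℝ)]
  have hK : ENNReal.ofReal (4 * ((M.H : ℝ) ^ 2 * β)) =
      4 * ((M.H : ℝ≥0∞) ^ 2 * ENNReal.ofReal β) := by
    rw [ENNReal.ofReal_mul (by norm_num), ENNReal.ofReal_mul (by positivity),
      ENNReal.ofReal_pow (by positivity)]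
    simp
  have h4 : ENNReal.ofReal 4 = 4 := by simp
  -- The additive `H` and the factor 4 are moved to the left so that the infimum stands alone and
  -- can be bounded partition by partition.
  rw [← tsub_le_iff_left, h4, mul_comm, ← ENNReal.div_le_iff_le_mul (by simp) (by simp)]
  refine le_iInf fun Xoff => le_iInf fun Xon => le_iInf fun hX => ?_
  rw [ENNReal.div_le_iff_le_mul (by simp) (by simp), tsub_le_iff_left]
  by_cases hcoff : M.cOff G πoff Xoff = ∞
  -- In `ℝ≥0∞` one has `0 * ∞ = 0`, so the bound is infinite here only because this factor is
  -- nonzero.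
  · have hfac : ENNReal.ofReal β * (M.H : ℝ≥0∞) ^ 4 * ((Non : ℝ≥0∞) ^ 2 / (Noff : ℝ≥0∞)) ≠ 0 := by
      have h1 : ENNReal.ofReal β ≠ 0 := by simp; linarith
      have h2 : (M.H : ℝ≥0∞) ^ 4 ≠ 0 := pow_ne_zero _ (by exact_mod_cast (by omega : M.H ≠ 0))
      have h3 : (Non : ℝ≥0∞) ^ 2 ≠ 0 := pow_ne_zero _ (by exact_mod_cast (by omega : Non ≠ 0))
      exact mul_ne_zero (mul_ne_zero h1 h2) (ENNReal.div_ne_zero.2 ⟨h3, ENNReal.natCast_ne_top _⟩)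
    rw [hcoff, ENNReal.mul_top hfac, ENNReal.top_rpow_of_pos (by norm_num), top_add,
      ENNReal.top_mul (by norm_num), add_top]
    exact le_top
  refine (ofReal_regret_le hsel hB hC hH hoff hw hD hX hcoff).trans (add_le_add_right ?_ _)
  rw [hK, add_mul]
  refine add_le_add (le_of_eq ?_) ?_
  -- With `4 w = 4 H² β` the offline part is exactly 4 times its square root; the online part below
  -- needs only a factor 2.
  · rw [← mul_assoc, ← sq_mul_rpow_half, mul_comm _ (4 : ℝ≥0∞), ← sq_mul_rpow_half]
    congr 1
    simp only [div_eq_mul_inv]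
    ring
  · rw [← sq_mul_rpow_half, mul_comm _ (4 : ℝ≥0∞), ← sq_mul_rpow_half]
    refine ENNReal.rpow_le_rpow ?_ (by norm_num)
    calc (M.H : ℝ≥0∞) ^ 2 * (Non * (4 * ((M.H : ℝ≥0∞) ^ 2 * ENNReal.ofReal β) * M.cOn G Xon Non))
        = 4 * (ENNReal.ofReal β * (M.H : ℝ≥0∞) ^ 4 * Non * M.cOn G Xon Non) := by ring
      _ ≤ 4 ^ 2 * (ENNReal.ofReal β * (M.H : ℝ≥0∞) ^ 4 * Non * M.cOn G Xon Non) := by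
        gcongr
        norm_num

end

end MDP

end HybridRL

end

/-! ### The regret theorem. -/

theorem theorem1 :
    ∃ c₁ C : ℝ, 0 < c₁ ∧ 0 < C ∧
      ∀ (S : Type u) (A : Type v) [MeasurableSpace S] [MeasurableSpace A]
        (M : HybridRL.MDP S A) (F : ℕ → Set (S × A → ℝ)) (G : M.GreedyRule F)
        (πoff : HybridRL.Policy S A) (Noff Non : ℕ) (δ β : ℝ) (warm : Bool)
        (sel : (t : ℕ) → M.History Noff t → HybridRL.QFun S A),
        1 ≤ M.H → 1 ≤ Noff → 0 < δ → δ < 1 →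
        M.IsBoundedClass F → M.BellmanComplete F →
        M.coverNum F (1 / ((Noff + Non : ℕ) : ℝ≥0)) ≠ ⊤ →
        β = M.betaParam F c₁ (Noff + Non) δ →
        M.IsDiscGolf G ((M.H : ℝ) ^ 2 * β) warm Noff Non sel →
        M.runLaw G πoff sel Non
            {D | ¬ ENNReal.ofReal (M.regret G sel D) ≤
              (if warm then 0 else (M.H : ℝ≥0∞)) +
                ENNReal.ofReal C * M.regretBound G πoff Noff Non β} ≤
          ENNReal.ofReal δ := by
  refine ⟨64, 4, by norm_num, by norm_num, ?_⟩
  intro S A _ _ M F G πoff Noff Non δ β warm sel hH hoff hδ hδ1 hB hC hcov hβ hsel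
  -- Without online episodes the regret is an empty sum. Otherwise `N ≥ 2`, which gives `β ≥ 64 log
  -- 2 ≥ 1`.
  rcases Nat.eq_zero_or_pos Non with rfl | hon
  · have h0 : ∀ D : M.History Noff 0, M.regret G sel D = 0 := fun D => by
      simp [HybridRL.MDP.regret]
    simp [h0]
  · have hlog := HybridRL.MDP.log_two_le_log hC (by omega : 2 ≤ Noff + Non) hH hδ hδ1 hcov
    have hβ1 : 1 ≤ β := by
      have := Real.log_two_gt_d9
      rw [hβ, HybridRL.MDP.betaParam]
      linarith
    refine le_trans (measure_mono ?_)
      (HybridRL.MDP.runLaw_not_concentrated_le hsel hB hC πoff hH hoff hon hδ hδ1 hcov)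
    intro D hD hconc
    rw [← hβ] at hconc
    exact hD (HybridRL.MDP.ofReal_regret_le_regretBound hsel hB hC hH hoff hon hβ1 hconc)
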